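/- A \emph{stratified group} is a finite-dimensional real Lie algebra $V$ with a fixed decomposition $V=V_1\oplus\dots\oplus V_s$ such that $[V_i,V_j]\subset V_{i+j}$ and $[V_1,V_j]=V_{j+1}$ for all $i,j\ge 1$ (where $V_k=\{0\}$ for $k>s$) and $V_s\neq\{0\}$ (the trivial case $V=\{0\}$, $s=0$ being allowed), endowed with the group operation given by the Baker--Campbell--Hausdorff formula \[ pq=\sum_{n\ge 1}\frac{(-1)^{n-1}}{n}\sum_{r_j+s_j>0,\ j=1,\dots,n}\frac{[p^{r_1}q^{s_1}\cdots p^{r_n}q^{s_n}]}{\sum_{j=1}^n(r_j+s_j)\,\prod_{j=1}^n r_j!\,s_j!}=p+q+\tfrac12[p,q]+\cdots, \] where $[p^{r_1}q^{s_1}\cdots p^{r_n}q^{s_n}]$ denotes the right-nested iterated bracket of the word; the neutral element is $0$ and $p^{-1}=-p$. Its dilations $\delta_\lambda$, $\lambda>0$, are the linear maps with $\delta_\lambda v=\lambda^j v$ for $v\in V_j$. A \emph{homogeneous distance} is a distance $\rho$ on $V$ with $\rho(gx,gy)=\rho(x,y)$ and $\rho(\delta_\lambda x,\delta_\lambda y)=\lambda\rho(x,y)$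 for all $g,x,y\in V$ and $\lambda>0$. A \emph{Carnot group} is a stratified group with a homogeneous distance; its topology is that of the finite-dimensional vector space $V$. Let $(\mathbb G,\rho)$ and $(\mathbb G',\rho')$ be Carnot groups, let $\Omega\subset\mathbb G$ be open and let $f:\Omega\to\mathbb G'$. Let $\mathrm{Hom}_h(\mathbb G;\mathbb G')$ be the set of homogeneous morphisms, i.e. of linear Lie algebra morphisms $L$ with $L(V_j)\subset V_j'$ for all $j$, with the distance $d(L,M)=\sup_{v\neq 0}\rho'(L(v),M(v))/\rho(0,v)$. The map $f$ is \emph{Pansu differentiable} at $p\in\Omega$, with Pansu differential $D_Hf_p=L\in\mathrm{Hom}_h(\mathbb G;\mathbb G')$, if \[ \lim_{x\to p}\frac{\rho'\big(f(p)^{-1}f(x),\,L(p^{-1}x)\big)}{\rho(p,x)}=0; \] it is \emph{of class $C^1_H$ on $\Omega$} if it is Pansu differentiable at every point of $\Omega$ and $p\mapsto D_Hf_p$ is continuous from $\Omega$ to $\mathrm{Hom}_h(\mathbb G;\mathbb G')$; and it is \emph{strictly Pansu differentiable} at $p\in\Omega$ if there is $L\in\mathrm{Hom}_h(\mathbb G;\mathbb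 G')$ such that \[ \lim_{\varepsilon\to0^+}\ \sup\left\{\frac{\rho'\big(f(y)^{-1}f(x),\,L(y^{-1}x)\big)}{\rho(x,y)}\ :\ x,y\in\Omega,\ \rho(p,x)<\varepsilon,\ \rho(p,y)<\varepsilon,\ x\neq y\right\}=0 . \] Then $f$ is of class $C^1_H$ on $\Omega$ if and only if $f$ is strictly Pansu differentiable at every point of $\Omega$. -/

import Mathlib

open Filter Topology
open scoped ENNReal

noncomputable section

namespace Carnot

/-- A stratification of step `step` of a real Lie algebra `V`: a direct sum decomposition
`V = V₁ ⊕ ⋯ ⊕ V_step` with `[V_i, V_j] ⊆ V_{i+j}` (this and the decomposition are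
Mathlib's `GradedLieAlgebra`), `[V₁, V_j] = V_{j+1}` for all `j ≥ 1`, and `V_step ≠ {0}`.
The layers are indexed by `ℕ`, with the convention `V_k = {0}` for `k = 0` and for `k > step`.
The zero Lie algebra is allowed, with `step = 0`. -/
structure Stratification (V : Type*) [LieRing V] [LieAlgebra ℝ V] where
  step : ℕ
  layer : ℕ → Submodule ℝ V
  graded : GradedLieAlgebra layer
  layer_zero : layer 0 = ⊥
  layer_of_step_lt : ∀ k, step < k → layer k = ⊥
  span_bracket : ∀ j, 1 ≤ j →
    Submodule.span ℝ {x : V | ∃ v ∈ layer 1, ∃ w ∈ layer j, ⁅v, w⁆ = x} = layer (j + 1)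
  layer_step_ne_bot : step ≠ 0 → layer step ≠ ⊥

attribute [instance] Stratification.graded

/-- The right-nested bracket `[a₁, [a₂, … [a_{k-1}, a_k] … ]]` of a nonempty list of vectors. -/
def nestedBracket {V : Type*} [LieRing V] : List V → V
  | [] => 0
  | [a] => a
  | a :: b :: l => ⁅a, nestedBracket (b :: l)⁆

namespace Stratification

variable {V : Type*} [LieRing V] [LieAlgebra ℝ V] (S : Stratification V)

/-- The dilation `δ_t`: multiplication by `t ^ j` on the layer `V_j`. -/
def dilation (t : ℝ) (v : V) : V :=
  ∑ j ∈ Finset.range (S.step + 1), t ^ j • (DirectSum.decompose S.layer v j : V)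

/-- The pairs `(r, s)` of exponents with `r + s > 0`. Pairs with `r > step` or `s > step` are
left out: they only occur in words of more than `step` letters, whose nested brackets vanish
(see `nestedBracket_eq_zero` below). -/
def exponents : Finset (ℕ × ℕ) :=
  (Finset.range (S.step + 1) ×ˢ Finset.range (S.step + 1)).filter fun a => 0 < a.1 + a.2

/-- The group law on `V` given by the Baker-Campbell-Hausdorff formula (in Dynkin's form)
`p q = ∑_{n ≥ 1} (-1)^{n-1}/n ∑_{r_j + s_j > 0}
  [p^{r_1} q^{s_1} ⋯ p^{r_n} q^{s_n}] / ((∑_j (r_j + s_j)) ∏_j r_j! s_j!)`.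
The terms with `n > step` vanish, see `nestedBracket_eq_zero`. The neutral element is `0`, and the
inverse of `p` is `-p`. -/
def mul (p q : V) : V :=
  ∑ n ∈ Finset.Icc 1 S.step, ((-1 : ℝ) ^ (n - 1) / (n : ℝ)) •
    ∑ w ∈ Fintype.piFinset (fun _ : Fin n => S.exponents),
      (((∑ j, ((w j).1 + (w j).2) : ℕ) : ℝ) *
          ((∏ j, (w j).1.factorial * (w j).2.factorial : ℕ) : ℝ))⁻¹ •
        nestedBracket
          (List.ofFn fun j => List.replicate (w j).1 p ++ List.replicate (w j).2 q).flatten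

theorem nestedBracket_mem (l : List V) :
    nestedBracket l ∈ ⨆ k : {k : ℕ // l.length ≤ k}, S.layer k := by
  have htop : ∀ a : V, a ∈ ⨆ k : ℕ, S.layer k := fun a => by
    rw [(DirectSum.Decomposition.isInternal S.layer).submodule_iSup_eq_top]; trivial
  induction l using nestedBracket.induct with
  | case1 => exact Submodule.zero_mem _
  | case2 a =>
    have hle : (⨆ k : ℕ, S.layer k) ≤ ⨆ k : {k : ℕ // [a].length ≤ k}, S.layer k := by
      refine iSup_le fun k => ?_
      rcases Nat.eq_zero_or_pos k with rfl | hk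
      · rw [S.layer_zero]; exact bot_le
      · exact le_iSup (fun k : {k : ℕ // [a].length ≤ k} => S.layer k) ⟨k, hk⟩
    exact hle (htop a)
  | case3 a b l ih =>
    simp only [nestedBracket]
    refine Submodule.iSup_induction (fun k : {k : ℕ // (b :: l).length ≤ k} => S.layer k)
      (motive := fun x => ⁅a, x⁆ ∈ ⨆ k : {k : ℕ // (a :: b :: l).length ≤ k}, S.layer k)
      ih ?_ ?_ ?_
    · rintro ⟨k, hk⟩ x hx
      refine Submodule.iSup_induction S.layer
        (motive := fun y => ⁅y, x⁆ ∈ ⨆ k : {k : ℕ // (a :: b :: l).length ≤ k}, S.layer k)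
        (htop a) ?_ ?_ ?_
      · intro i y hy
        rcases Nat.eq_zero_or_pos i with rfl | hi
        · rw [S.layer_zero, Submodule.mem_bot] at hy
          simp [hy]
        · have hik : (a :: b :: l).length ≤ i + k := by
            simp only [List.length_cons] at hk ⊢; omega
          exact Submodule.mem_iSup_of_mem
            (p := fun k : {k : ℕ // (a :: b :: l).length ≤ k} => S.layer k) ⟨i + k, hik⟩
            (SetLike.GradedBracket.bracket_mem hy hx)
      · simp
      · intro y z hy hz
        rw [add_lie]; exact Submodule.add_mem _ hy hz
    · simp
    · intro y z hy hz
      rw [lie_add]; exact Submodule.add_mem _ hy hz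

/-- Nested brackets of more than `step` letters vanish, so that the sum in `mul` is the full
Baker-Campbell-Hausdorff series. -/
theorem nestedBracket_eq_zero (l : List V) (h : S.step < l.length) : nestedBracket l = 0 := by
  have hl := S.nestedBracket_mem l
  have hbot : (⨆ k : {k : ℕ // l.length ≤ k}, S.layer k) = ⊥ := by
    rw [iSup_eq_bot]
    rintro ⟨k, hk⟩
    exact S.layer_of_step_lt k (lt_of_lt_of_le h hk)
  rwa [hbot, Submodule.mem_bot] at hl

end Stratification

/-- A homogeneous distance on the stratified group `(V, S)`: a distance function that is
left-invariant and 1-homogeneous with respect to the dilations. A stratified group with a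
homogeneous distance is a Carnot group. -/
structure HomogeneousDistance {V : Type*} [LieRing V] [LieAlgebra ℝ V]
    (S : Stratification V) where
  dist : V → V → ℝ
  dist_eq_zero : ∀ x y, dist x y = 0 ↔ x = y
  dist_comm : ∀ x y, dist x y = dist y x
  dist_triangle : ∀ x y z, dist x z ≤ dist x y + dist y z
  dist_mul_left : ∀ g x y, dist (S.mul g x) (S.mul g y) = dist x y
  dist_dilation : ∀ t : ℝ, 0 < t → ∀ x y, dist (S.dilation t x) (S.dilation t y) = t * dist x y

/-- A homogeneous morphism: a linear map that is a morphism of Lie algebras and maps each layer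
`V_j` into `V'_j`. -/
structure HomogeneousHom {V V' : Type*} [LieRing V] [LieAlgebra ℝ V] [LieRing V']
    [LieAlgebra ℝ V'] (S : Stratification V) (S' : Stratification V') extends V →ₗ⁅ℝ⁆ V' where
  map_layer : ∀ j, ∀ v ∈ S.layer j, toLieHom v ∈ S'.layer j

section Pansu

variable {V V' : Type*} [LieRing V] [LieAlgebra ℝ V] [LieRing V'] [LieAlgebra ℝ V']
  {S : Stratification V} {S' : Stratification V'}
  (ρ : HomogeneousDistance S) (ρ' : HomogeneousDistance S')

/-- The distance `sup_{v ≠ 0} ρ'(L v, M v) / ρ(0, v)` between two homogeneous morphisms. -/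
def homDist (L M : HomogeneousHom S S') : ℝ≥0∞ :=
  ⨆ (v : V) (_ : v ≠ 0), ENNReal.ofReal (ρ'.dist (L.toLieHom v) (M.toLieHom v) / ρ.dist 0 v)

/-- `L` is a Pansu differential at `p` of the map `f` defined on `Ω`. -/
def HasPansuDifferentialAt [TopologicalSpace V] (Ω : Set V) (f : V → V')
    (L : HomogeneousHom S S') (p : V) : Prop :=
  Tendsto
    (fun x => ρ'.dist (S'.mul (-f p) (f x)) (L.toLieHom (S.mul (-p) x)) / ρ.dist p x)
    (𝓝[Ω \ {p}] p) (𝓝 0)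

/-- `f` is of class `C¹_H` on `Ω`: it is Pansu differentiable at all points of `Ω`, and the Pansu
differential depends continuously on the point. -/
def IsC1H [TopologicalSpace V] (Ω : Set V) (f : V → V') : Prop :=
  ∃ D : V → HomogeneousHom S S',
    (∀ p ∈ Ω, HasPansuDifferentialAt ρ ρ' Ω f (D p) p) ∧
      ∀ p ∈ Ω, Tendsto (fun q => homDist ρ ρ' (D q) (D p)) (𝓝[Ω] p) (𝓝 0)

/-- `f`, defined on `Ω`, is strictly Pansu differentiable at `p`. The supremum is taken in
`[0, ∞]`. -/
def IsStrictlyPansuDifferentiableAt (Ω : Set V) (f : V → V') (p : V) : Prop :=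
  ∃ L : HomogeneousHom S S',
    Tendsto
      (fun ε : ℝ =>
        ⨆ (x : V) (y : V) (_ : x ∈ Ω ∧ y ∈ Ω ∧ ρ.dist p x < ε ∧ ρ.dist p y < ε ∧ x ≠ y),
          ENNReal.ofReal
            (ρ'.dist (S'.mul (-f y) (f x)) (L.toLieHom (S.mul (-y) x)) / ρ.dist x y))
      (𝓝[>] 0) (𝓝 0)

end Pansu

end Carnot

end

/-!
Strict differentiability at `p` bounds the difference quotients based at all `q` near `p`. Blowing
up at such a `q` turns this into `ρ' (D_q v) (D_p v) ≤ η ρ(0, v)`, which is the continuity of the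
differential.

Conversely, let `y → p`, `r → 0⁺`. For a horizontal vector `a`, the curve
`t ↦ δ_{1/r} (f(y)⁻¹ f(y δ_r (t a)))` is differentiable, with left logarithmic derivative the
differential of `f` at `y δ_r (t a)` applied to `a`. This tends to `D_p a` uniformly in
`t ∈ [0, 1]`, and since the group law is triangular, the curve can be integrated component by
component: its endpoint tends to `D_p a`. The families `u` for which
`δ_{1/r} (f(y)⁻¹ f(y δ_r u))` tends to `D_p (lim u)` for every choice of `y → p` are closed under
products and inverses. As the first layer generates the group, every convergent family is of this
kind, and the compactness of the unit sphere of `ρ` then gives the uniform limit.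

That the Baker-Campbell-Hausdorff product is associative is seen in a faithful nilpotent
representation, where the exponential turns it into composition. This is Dynkin's form of the
formula: in `log (exp X * exp Y)`, the words are replaced by their brackets by means of the Euler
operator, which multiplies a word by its length.
-/

namespace Carnot

section TruncatedExpLog

open Polynomial

/-- The exponential series truncated at degree `M`, as a polynomial. -/
noncomputable def expPoly (M : ℕ) : ℚ[X] :=
  ∑ k ∈ Finset.range M, C ((k.factorial : ℚ)⁻¹) * X ^ k

/-- The series of `log (1 + X)` up to degree `M`, as a polynomial. -/
noncomputable def logPoly (M : ℕ) : ℚ[X] :=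
  ∑ n ∈ Finset.range M, C ((-1 : ℚ) ^ n / (n + 1)) * X ^ (n + 1)

theorem expPoly_succ (M : ℕ) :
    expPoly (M + 1) = expPoly M + C ((M.factorial : ℚ)⁻¹) * X ^ M :=
  Finset.sum_range_succ _ _

theorem derivative_expPoly_succ (M : ℕ) : derivative (expPoly (M + 1)) = expPoly M := by
  rw [expPoly, Finset.sum_range_succ', derivative_add, derivative_sum, expPoly]
  simp only [pow_zero, mul_one, derivative_C, add_zero]
  refine Finset.sum_congr rfl fun k _ => ?_
  rw [derivative_C_mul_X_pow, Nat.factorial_succ]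
  congr 2
  have : (k.factorial : ℚ) ≠ 0 := by positivity
  push_cast
  field_simp

theorem one_add_X_mul_derivative_logPoly (M : ℕ) :
    (1 + X) * derivative (logPoly M) = 1 - (-X) ^ M := by
  have geometric : derivative (logPoly M) = ∑ n ∈ Finset.range M, (-X : ℚ[X]) ^ n := by
    rw [logPoly, derivative_sum]
    refine Finset.sum_congr rfl fun k _ => ?_
    rw [derivative_C_mul_X_pow, neg_pow (X : ℚ[X]), Nat.add_sub_cancel]
    congr 1
    push_cast
    rw [div_mul_cancel₀ _ (by positivity)]
    simp
  rw [geometric]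
  simpa using mul_neg_geom_sum (-X : ℚ[X]) M

theorem X_dvd_expPoly_succ_sub_one (M : ℕ) : X ∣ expPoly (M + 1) - 1 := by
  rw [X_dvd_iff, expPoly, Finset.sum_range_succ']
  simp [coeff_X_pow]

theorem X_dvd_logPoly (M : ℕ) : X ∣ logPoly M :=
  Finset.dvd_sum fun n _ => Dvd.dvd.mul_left (dvd_pow_self X n.succ_ne_zero) _

theorem X_pow_succ_dvd_of_X_pow_dvd_derivative {M : ℕ} {g : ℚ[X]} (e : ℚ) (h0 : X ∣ g)
    (h : X ^ M ∣ (1 + C e * X) * derivative g - C e * g) : X ^ (M + 1) ∣ g := by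
  rw [X_pow_dvd_iff] at h ⊢
  intro d
  induction d with
  | zero => exact fun _ => X_dvd_iff.1 h0
  | succ k ih =>
    intro hk
    have hgk := ih (by omega)
    have hcoeff := h k (by omega)
    rw [add_mul, one_mul, mul_assoc, coeff_sub, coeff_add, coeff_C_mul, coeff_C_mul, hgk,
      coeff_derivative] at hcoeff
    rcases k with _ | k
    · simpa using hcoeff
    · rw [coeff_X_mul, coeff_derivative, hgk] at hcoeff
      have : (k : ℚ) + 1 + 1 ≠ 0 := by positivity
      simpa [this] using hcoeff

/-- The two sides have the same derivative up to higher order, since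
`(log ∘ (exp - 1))' = exp / (1 + (exp - 1))`. -/
theorem X_pow_dvd_logPoly_comp_sub_X (M : ℕ) :
    X ^ M ∣ (logPoly M).comp (expPoly M - 1) - X := by
  rcases M with _ | M
  · simp
  have hX := X_dvd_expPoly_succ_sub_one M
  refine X_pow_succ_dvd_of_X_pow_dvd_derivative 0 ?_ ?_
  · obtain ⟨q, hq⟩ := X_dvd_logPoly (M + 1)
    rw [hq, mul_comp, X_comp]
    exact dvd_sub (hX.mul_right _) dvd_rfl
  set u := expPoly (M + 1) - 1 with hu
  set D := (derivative (logPoly (M + 1))).comp u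
  have hD : (1 + u) * D = 1 - (-u) ^ (M + 1) := by
    simpa using congrArg (fun r => r.comp u) (one_add_X_mul_derivative_logPoly (M + 1))
  have hderiv : (1 + C 0 * X) * derivative ((logPoly (M + 1)).comp u - X) -
      C 0 * ((logPoly (M + 1)).comp u - X) = expPoly M * D - 1 := by
    rw [derivative_sub, derivative_comp, derivative_X, hu, derivative_sub, derivative_one,
      sub_zero, derivative_expPoly_succ]
    simp only [map_zero, zero_mul, add_zero, one_mul, sub_zero, D, hu]
  have hremainder : expPoly M * D - 1 =
      -(-u) ^ (M + 1) - C ((M.factorial : ℚ)⁻¹) * D * X ^ M := by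
    linear_combination hD - D * expPoly_succ M - D * hu
  rw [hderiv, hremainder, neg_pow u]
  exact dvd_sub (dvd_neg.2 (Dvd.dvd.mul_left
    ((pow_dvd_pow X M.le_succ).trans (pow_dvd_pow_of_dvd hX _)) _)) (dvd_mul_left _ _)

/-- Both `exp ∘ log (1 + X)` and `1 + X` solve `(1 + X) y' = y` up to higher order. -/
theorem X_pow_dvd_expPoly_comp_sub_one_add_X (M : ℕ) :
    X ^ M ∣ (expPoly M).comp (logPoly M) - (1 + X) := by
  rcases M with _ | M
  · simp
  have hX := X_dvd_logPoly (M + 1)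
  have hexp := congrArg (fun r => r.comp (logPoly (M + 1))) (expPoly_succ M)
  have hlog := one_add_X_mul_derivative_logPoly (M + 1)
  set L := logPoly (M + 1)
  refine X_pow_succ_dvd_of_X_pow_dvd_derivative 1 ?_ ?_
  · obtain ⟨q, hq⟩ := X_dvd_expPoly_succ_sub_one M
    have hcomp : (expPoly (M + 1)).comp L - (1 + X) = L * q.comp L - X := by
      rw [sub_eq_iff_eq_add.1 hq]
      simp only [add_comp, mul_comp, X_comp, one_comp]
      ring
    rw [hcomp]
    exact dvd_sub (hX.mul_right _) dvd_rfl
  simp only [add_comp, mul_comp, C_comp, pow_comp, X_comp] at hexp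
  have hremainder : (1 + C 1 * X) * derivative ((expPoly (M + 1)).comp L - (1 + X)) -
      C 1 * ((expPoly (M + 1)).comp L - (1 + X)) =
        -((expPoly M).comp L * (-X) ^ (M + 1)) - C ((M.factorial : ℚ)⁻¹) * L ^ M := by
    rw [derivative_sub, derivative_comp, derivative_add, derivative_X, derivative_one,
      derivative_expPoly_succ, C_1]
    linear_combination (expPoly M).comp L * hlog - hexp
  rw [hremainder, neg_pow (X : ℚ[X])]
  exact dvd_sub (dvd_neg.2 (Dvd.dvd.mul_left (Dvd.dvd.mul_left (pow_dvd_pow X M.le_succ) _) _))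
    (Dvd.dvd.mul_left (pow_dvd_pow_of_dvd hX _) _)

variable {A : Type*} [Ring A] [Algebra ℚ A] {M : ℕ} {a b u : A}

theorem aeval_expPoly (ha : a ^ M = 0) : aeval a (expPoly M) = IsNilpotent.exp a := by
  rw [IsNilpotent.exp_eq_sum ha, expPoly, map_sum]
  refine Finset.sum_congr rfl fun k _ => ?_
  rw [map_mul, aeval_C, map_pow, aeval_X, Algebra.smul_def]

theorem aeval_exp_sub_one_logPoly (ha : a ^ M = 0) :
    aeval (IsNilpotent.exp a - 1) (logPoly M) = a := by
  obtain ⟨q, hq⟩ := X_pow_dvd_logPoly_comp_sub_X M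
  have := congrArg (aeval a) hq
  rwa [map_sub, aeval_comp, map_sub, aeval_expPoly ha, map_mul, map_pow, aeval_X, ha, zero_mul,
    map_one, sub_eq_zero] at this

theorem aeval_logPoly_pow_eq_zero (hu : u ^ M = 0) : aeval u (logPoly M) ^ M = 0 := by
  obtain ⟨q, hq⟩ := pow_dvd_pow_of_dvd (X_dvd_logPoly M) M
  rw [← map_pow, hq, map_mul, map_pow, aeval_X, hu, zero_mul]

theorem exp_aeval_logPoly (hu : u ^ M = 0) :
    IsNilpotent.exp (aeval u (logPoly M)) = 1 + u := by
  obtain ⟨q, hq⟩ := X_pow_dvd_expPoly_comp_sub_one_add_X M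
  have := congrArg (aeval u) hq
  rwa [map_sub, aeval_comp, aeval_expPoly (aeval_logPoly_pow_eq_zero hu), map_mul, map_pow,
    aeval_X, hu, zero_mul, map_add, map_one, aeval_X, sub_eq_zero] at this

theorem aeval_zero_logPoly (M : ℕ) : aeval (0 : A) (logPoly M) = 0 := by
  obtain ⟨q, hq⟩ := X_dvd_logPoly M
  rw [hq, map_mul, aeval_X, zero_mul]

theorem exp_injective_of_isNilpotent (ha : IsNilpotent a) (hb : IsNilpotent b)
    (h : IsNilpotent.exp a = IsNilpotent.exp b) : a = b := by
  obtain ⟨m, hm⟩ := ha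
  obtain ⟨n, hn⟩ := hb
  rw [← aeval_exp_sub_one_logPoly (pow_eq_zero_of_le (le_max_left m n) hm), h,
    aeval_exp_sub_one_logPoly (pow_eq_zero_of_le (le_max_right m n) hn)]

end TruncatedExpLog

section DynkinSum

/-- The two-letter word `p^{r_1} q^{s_1} ⋯ p^{r_n} q^{s_n}`, with `true` for `p` and `false`
for `q`. -/
def word {n : ℕ} (w : Fin n → ℕ × ℕ) : List Bool :=
  (List.ofFn fun j => List.replicate (w j).1 true ++ List.replicate (w j).2 false).flatten

/-- The nonzero pairs of exponents bounded by `M`. -/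
def exponentPairs (M : ℕ) : Finset (ℕ × ℕ) :=
  (Finset.range (M + 1) ×ˢ Finset.range (M + 1)).filter fun a => 0 < a.1 + a.2

/-- The product `P^{r_1} Q^{s_1} ⋯` obtained by substituting `P` and `Q` in a word. -/
def wordProd {R : Type*} [Monoid R] (P Q : R) (l : List Bool) : R :=
  (l.map fun b => cond b P Q).prod

/-- The right-nested bracket `[P^{r_1} Q^{s_1} ⋯]` obtained by substituting `P` and `Q` in a
word. -/
def wordBracket {L : Type*} [LieRing L] (P Q : L) (l : List Bool) : L :=
  nestedBracket (l.map fun b => cond b P Q)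

theorem mem_exponentPairs {M : ℕ} {a : ℕ × ℕ} :
    a ∈ exponentPairs M ↔ (a.1 ≤ M ∧ a.2 ≤ M) ∧ 0 < a.1 + a.2 := by
  simp [exponentPairs]

theorem word_map {α : Type*} (p q : α) {n : ℕ} (w : Fin n → ℕ × ℕ) :
    (word w).map (fun b => cond b p q) =
      (List.ofFn fun j => List.replicate (w j).1 p ++ List.replicate (w j).2 q).flatten := by
  simp [word, List.map_flatten, List.map_ofFn, Function.comp_def]

theorem word_cons {n : ℕ} (a : ℕ × ℕ) (w : Fin n → ℕ × ℕ) :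
    word (Fin.cons a w : Fin (n + 1) → ℕ × ℕ) =
      List.replicate a.1 true ++ (List.replicate a.2 false ++ word w) := by
  simp [word, List.ofFn_succ]

theorem length_word {n : ℕ} (w : Fin n → ℕ × ℕ) :
    (word w).length = ∑ j, ((w j).1 + (w j).2) := by
  simp [word, Function.comp_def, List.sum_ofFn]

theorem le_length_word {M n : ℕ} {w : Fin n → ℕ × ℕ}
    (hw : w ∈ Fintype.piFinset fun _ => exponentPairs M) : n ≤ (word w).length := by
  rw [length_word]
  calc n = ∑ _j : Fin n, 1 := by simp
    _ ≤ _ := Finset.sum_le_sum fun j _ =>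
      (mem_exponentPairs.1 (Fintype.mem_piFinset.1 hw j)).2

theorem wordProd_word_cons {R : Type*} [Monoid R] (P Q : R) {n : ℕ} (a : ℕ × ℕ)
    (w : Fin n → ℕ × ℕ) :
    wordProd P Q (word (Fin.cons a w : Fin (n + 1) → ℕ × ℕ)) =
      P ^ a.1 * Q ^ a.2 * wordProd P Q (word w) := by
  simp [wordProd, word_cons, mul_assoc]

theorem sum_piFinset_fin_succ {ι E : Type*} [AddCommMonoid E] (s : Finset ι) {n : ℕ}
    (g : (Fin (n + 1) → ι) → E) :
    ∑ w ∈ Fintype.piFinset (fun _ => s), g w =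
      ∑ a ∈ s, ∑ w ∈ Fintype.piFinset (fun _ => s), g (Fin.cons a w) := by
  rw [← Finset.sum_product']
  refine Finset.sum_equiv (Fin.consEquiv fun _ => ι).symm (fun w => ?_) fun w _ => ?_
  · simp [Fin.forall_fin_succ, Fin.consEquiv, Fin.tail]
  · simp [Fin.consEquiv]

theorem sum_pow_eq_sum_prod_ofFn {R ι : Type*} [Semiring R] (s : Finset ι) (f : ι → R) (n : ℕ) :
    (∑ a ∈ s, f a) ^ n =
      ∑ w ∈ Fintype.piFinset (fun _ : Fin n => s), (List.ofFn fun j => f (w j)).prod := by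
  induction n with
  | zero => simp
  | succ n ih =>
    rw [pow_succ', ih, Finset.sum_mul_sum, sum_piFinset_fin_succ]
    simp [List.ofFn_succ]

variable (K : Type*) [Field K] {E : Type*} [AddCommGroup E] [Module K E] {F : Type*}
  [AddCommGroup F] [Module K F] {M m : ℕ} {c d : List Bool → E}

/-- The sum `∑_n (-1)^{n-1}/n ∑_w (∏_j r_j! s_j!)⁻¹ c(w)` over words
`w = p^{r_1} q^{s_1} ⋯ p^{r_n} q^{s_n}` with `n`, `r_j`, `s_j` at most `M`: the weights are the
coefficients of `w` in `log (e^p e^q)`. -/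
noncomputable def dynkinSum (M : ℕ) (c : List Bool → E) : E :=
  ∑ n ∈ Finset.Icc 1 M, ((-1 : K) ^ (n - 1) / n) •
    ∑ w ∈ Fintype.piFinset (fun _ : Fin n => exponentPairs M),
      ((∏ j, (w j).1.factorial * (w j).2.factorial : ℕ) : K)⁻¹ • c (word w)

theorem map_dynkinSum (φ : E →ₗ[K] F) (M : ℕ) (c : List Bool → E) :
    φ (dynkinSum K M c) = dynkinSum K M fun l => φ (c l) := by
  simp only [dynkinSum, map_sum, map_smul]

theorem dynkinSum_sub (M : ℕ) (c d : List Bool → E) :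
    dynkinSum K M (fun l => c l - d l) = dynkinSum K M c - dynkinSum K M d := by
  simp only [dynkinSum, smul_sub, Finset.sum_sub_distrib]

variable {K}

theorem dynkinSum_congr (h : ∀ l, l ≠ [] → c l = d l) : dynkinSum K M c = dynkinSum K M d := by
  refine Finset.sum_congr rfl fun n hn => congrArg _ (Finset.sum_congr rfl fun w hw => ?_)
  rw [h _ (List.ne_nil_of_length_pos ((Finset.mem_Icc.1 hn).1.trans (le_length_word hw)))]

theorem dynkinSum_eq_of_le (hc : ∀ l, m < l.length → c l = 0) (hM : m ≤ M) :
    dynkinSum K M c = dynkinSum K m c := by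
  symm
  have hmono : exponentPairs m ⊆ exponentPairs M := fun a ha => by
    rw [mem_exponentPairs] at ha ⊢; omega
  have hinner : ∀ n, ∑ w ∈ Fintype.piFinset (fun _ : Fin n => exponentPairs m),
        ((∏ j, (w j).1.factorial * (w j).2.factorial : ℕ) : K)⁻¹ • c (word w) =
      ∑ w ∈ Fintype.piFinset (fun _ : Fin n => exponentPairs M),
        ((∏ j, (w j).1.factorial * (w j).2.factorial : ℕ) : K)⁻¹ • c (word w) := fun n => by
    refine Finset.sum_subset (Fintype.piFinset_subset _ _ fun _ => hmono) fun w hwM hwm => ?_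
    rw [hc, smul_zero]
    simp only [Fintype.mem_piFinset, mem_exponentPairs] at hwM hwm
    push Not at hwm
    obtain ⟨j, hj⟩ := hwm
    have hle := Finset.single_le_sum (f := fun j => (w j).1 + (w j).2)
      (fun _ _ => Nat.zero_le _) (Finset.mem_univ j)
    have := hwM j
    rw [length_word]
    by_contra!
    omega
  simp only [dynkinSum, hinner]
  refine Finset.sum_subset (Finset.Icc_subset_Icc_right hM) fun n hnM hnm => ?_
  rw [Finset.sum_eq_zero, smul_zero]
  intro w hw
  have := le_length_word hw
  rw [hc, smul_zero]
  simp only [Finset.mem_Icc] at hnM hnm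
  omega

theorem dynkinSum_two [CharZero K] (hc : ∀ l, 3 ≤ l.length → c l = 0) :
    dynkinSum K 2 c =
      c [true] + c [false] + (2 : K)⁻¹ • (c [true, false] - c [false, true]) := by
  have hpairs : exponentPairs 2 =
      {(0, 1), (0, 2), (1, 0), (1, 1), (1, 2), (2, 0), (2, 1), (2, 2)} := by decide
  simp [dynkinSum, Finset.sum_Icc_succ_top, sum_piFinset_fin_succ, hpairs, word, hc,
    List.replicate]
  module

/-- Modulo `I`, only the words of at most two letters contribute. -/
theorem dynkinSum_sub_mem [CharZero K] (I : Submodule K E) (hc : ∀ l, 3 ≤ l.length → c l ∈ I)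
    (hM : 2 ≤ M) :
    dynkinSum K M c -
      (c [true] + c [false] + (2 : K)⁻¹ • (c [true, false] - c [false, true])) ∈ I := by
  have hquot : ∀ l, 2 < l.length → I.mkQ (c l) = 0 := fun l hl => by simpa using hc l hl
  rw [← Submodule.Quotient.mk_eq_zero, ← Submodule.mkQ_apply, map_sub, map_dynkinSum,
    dynkinSum_eq_of_le hquot hM, dynkinSum_two hquot]
  simp

end DynkinSum

section Dynkin

open Polynomial

attribute [local instance] LieRing.ofAssociativeRing

variable (K : Type*) [Field K]

section LieAlgebra

variable {L L' : Type*} [LieRing L] [LieAlgebra K L] [LieRing L'] [LieAlgebra K L']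

/-- The Baker–Campbell–Hausdorff series of `p` and `q` in Dynkin's form, truncated at blocks and
exponents at most `M`. -/
noncomputable def dynkin (M : ℕ) (p q : L) : L :=
  dynkinSum K M fun l => (l.length : K)⁻¹ • wordBracket p q l

variable {K}

theorem map_nestedBracket (φ : L →ₗ⁅K⁆ L') (l : List L) :
    φ (nestedBracket l) = nestedBracket (l.map φ) := by
  induction l using nestedBracket.induct with
  | case1 => simp [nestedBracket]
  | case2 a => simp [nestedBracket]
  | case3 a b l ih => simp only [nestedBracket, LieHom.map_lie, ih, List.map_cons]

theorem map_wordBracket (φ : L →ₗ⁅K⁆ L') (p q : L) (l : List Bool) :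
    φ (wordBracket p q l) = wordBracket (φ p) (φ q) l := by
  rw [wordBracket, map_nestedBracket, wordBracket, List.map_map]
  congr 2
  funext b
  cases b <;> rfl

theorem wordBracket_cons (P Q : L) (b : Bool) {l : List Bool} (hl : l ≠ []) :
    wordBracket P Q (b :: l) = ⁅cond b P Q, wordBracket P Q l⁆ := by
  obtain ⟨c, l, rfl⟩ := List.exists_cons_of_ne_nil hl
  rfl

theorem map_dynkin (φ : L →ₗ⁅K⁆ L') (M : ℕ) (p q : L) :
    φ (dynkin K M p q) = dynkin K M (φ p) (φ q) := by
  rw [dynkin, ← LieHom.coe_toLinearMap, map_dynkinSum]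
  simp only [map_smul, LieHom.coe_toLinearMap, map_wordBracket, dynkin]

/-- If `-ad E` fixes `P` and `Q`, a product of `ad P` and `ad Q` turns `E` into a nested bracket.
This is what converts the associative words of `log (e^P e^Q)` into brackets. -/
theorem wordProd_ad_apply {P Q E : L} (hP : ⁅P, E⁆ = -P) (hQ : ⁅Q, E⁆ = -Q) {l : List Bool}
    (hl : l ≠ []) :
    wordProd (LieAlgebra.ad K L P) (LieAlgebra.ad K L Q) l E = -wordBracket P Q l := by
  have had (b : Bool) : cond b (LieAlgebra.ad K L P) (LieAlgebra.ad K L Q) =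
      LieAlgebra.ad K L (cond b P Q) := by cases b <;> rfl
  have hE (b : Bool) : ⁅cond b P Q, E⁆ = -cond b P Q := by cases b <;> assumption
  induction l with
  | nil => exact absurd rfl hl
  | cons b l ih =>
    rcases eq_or_ne l [] with rfl | hne
    · simp [wordProd, wordBracket, nestedBracket, had, hE]
    · rw [wordBracket_cons P Q b hne, wordProd, List.map_cons, List.prod_cons,
        Module.End.mul_apply, ← wordProd, ih hne, had, LieAlgebra.ad_apply, lie_neg]

end LieAlgebra

section Exp

variable {K} {A : Type*} [Ring A] [Algebra K A] {M : ℕ} {P Q Λ a : A}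

theorem prod_ofFn_smul (P Q : A) {n : ℕ} (w : Fin n → ℕ × ℕ) :
    (List.ofFn fun j => (((w j).1.factorial * (w j).2.factorial : ℕ) : K)⁻¹ •
        (P ^ (w j).1 * Q ^ (w j).2)).prod =
      ((∏ j, (w j).1.factorial * (w j).2.factorial : ℕ) : K)⁻¹ • wordProd P Q (word w) := by
  induction n with
  | zero => simp [word, wordProd]
  | succ n ih =>
    rw [List.ofFn_succ, List.prod_cons, ih, ← Fin.cons_self_tail w, wordProd_word_cons,
      Fin.prod_univ_succ, smul_mul_smul_comm, Nat.cast_mul (m := _ * _), mul_inv]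
    rfl

variable [Algebra ℚ A]

theorem exp_mulLeft (ha : IsNilpotent a) :
    IsNilpotent.exp (LinearMap.mulLeft K a) = LinearMap.mulLeft K (IsNilpotent.exp a) :=
  (IsNilpotent.map_exp ha (Algebra.lmul K A)).symm

theorem exp_mulRight (ha : IsNilpotent a) :
    IsNilpotent.exp (LinearMap.mulRight K a) = LinearMap.mulRight K (IsNilpotent.exp a) := by
  obtain ⟨k, hk⟩ := ha
  have hk' : LinearMap.mulRight K a ^ k = 0 := by rw [LinearMap.pow_mulRight, hk]; ext; simp
  rw [IsNilpotent.exp_eq_sum hk, IsNilpotent.exp_eq_sum hk']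
  ext x
  simp [LinearMap.pow_mulRight, Finset.mul_sum]

theorem exp_ad_apply (ha : IsNilpotent a) (x : A) :
    IsNilpotent.exp (LieAlgebra.ad K A a) x =
      IsNilpotent.exp a * x * IsNilpotent.exp (-a) := by
  have hsplit : LieAlgebra.ad K A a = LinearMap.mulLeft K a + LinearMap.mulRight K (-a) := by
    ext y; simp [LieRing.of_associative_ring_bracket, sub_eq_add_neg]
  rw [hsplit, IsNilpotent.exp_add_of_commute (LinearMap.commute_mulLeft_right _ _)
    ((LinearMap.isNilpotent_mulLeft_iff K a).2 ha)
    ((LinearMap.isNilpotent_mulRight_iff K (-a)).2 ha.neg), exp_mulLeft ha, exp_mulRight ha.neg]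
  simp [mul_assoc]

theorem exp_ad_mul_exp_ad (hP : IsNilpotent P) (hQ : IsNilpotent Q) (hΛ : IsNilpotent Λ)
    (h : IsNilpotent.exp Λ = IsNilpotent.exp P * IsNilpotent.exp Q) :
    IsNilpotent.exp (LieAlgebra.ad K A P) * IsNilpotent.exp (LieAlgebra.ad K A Q) =
      IsNilpotent.exp (LieAlgebra.ad K A Λ) := by
  have hneg : IsNilpotent.exp (-Λ) = IsNilpotent.exp (-Q) * IsNilpotent.exp (-P) := by
    refine left_inv_eq_right_inv (IsNilpotent.exp_neg_mul_exp_self hΛ) ?_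
    rw [h, mul_assoc, ← mul_assoc (IsNilpotent.exp Q), IsNilpotent.exp_mul_exp_neg_self hQ,
      one_mul, IsNilpotent.exp_mul_exp_neg_self hP]
  ext x
  rw [Module.End.mul_apply, exp_ad_apply hP, exp_ad_apply hQ, exp_ad_apply hΛ, h, hneg]
  simp only [mul_assoc]

variable [CharZero K]

theorem exp_mul_exp_sub_one (hP : P ^ (M + 1) = 0) (hQ : Q ^ (M + 1) = 0) :
    IsNilpotent.exp P * IsNilpotent.exp Q - 1 =
      ∑ a ∈ exponentPairs M, ((a.1.factorial * a.2.factorial : ℕ) : K)⁻¹ •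
        (P ^ a.1 * Q ^ a.2) := by
  have hpairs : exponentPairs M =
      (Finset.range (M + 1) ×ˢ Finset.range (M + 1)).erase (0, 0) := by
    ext ⟨a, b⟩
    simp [exponentPairs]
    omega
  rw [IsNilpotent.exp_eq_sum hP, IsNilpotent.exp_eq_sum hQ, Finset.sum_mul_sum,
    ← Finset.sum_product', hpairs, ← Finset.add_sum_erase _ _ (a := ((0 : ℕ), (0 : ℕ))) (by simp)]
  simp only [Nat.factorial_zero, Nat.cast_one, inv_one, pow_zero, one_smul, mul_one,
    add_sub_cancel_left]
  refine Finset.sum_congr rfl fun a _ => ?_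
  rw [smul_mul_smul_comm, ← Rat.cast_smul_eq_qsmul K]
  push_cast
  rw [mul_inv]

theorem aeval_exp_mul_exp_sub_one_logPoly (hP : P ^ (M + 1) = 0) (hQ : Q ^ (M + 1) = 0) :
    aeval (IsNilpotent.exp P * IsNilpotent.exp Q - 1) (logPoly M) =
      dynkinSum K M (wordProd P Q) := by
  rw [logPoly, map_sum, dynkinSum, Finset.range_eq_Ico, ← Finset.Ico_add_one_right_eq_Icc]
  refine (Finset.sum_congr rfl fun k _ => ?_).trans (Finset.sum_Ico_add' _ 0 M 1)
  rw [map_mul, aeval_C, map_pow, aeval_X, ← Algebra.smul_def, ← Rat.cast_smul_eq_qsmul K,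
    exp_mul_exp_sub_one (K := K) hP hQ, sum_pow_eq_sum_prod_ofFn]
  simp only [prod_ofFn_smul, Nat.add_sub_cancel, Nat.cast_succ, Rat.cast_div,
    Rat.cast_pow, Rat.cast_neg, Rat.cast_one, Rat.cast_add, Rat.cast_natCast]

/-- Both sides are `log (e^{ad P} e^{ad Q})` applied to `E`. -/
theorem lie_eq_neg_dynkinSum_wordBracket {E : A} (hP : IsNilpotent P) (hQ : IsNilpotent Q)
    (hΛ : IsNilpotent Λ) (h : IsNilpotent.exp Λ = IsNilpotent.exp P * IsNilpotent.exp Q)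
    (hPE : ⁅P, E⁆ = -P) (hQE : ⁅Q, E⁆ = -Q) :
    ∀ᶠ M in Filter.atTop, ⁅Λ, E⁆ = -dynkinSum K M (wordBracket P Q) := by
  obtain ⟨i, hi⟩ := LieAlgebra.ad_nilpotent_of_nilpotent (R := K) hP
  obtain ⟨j, hj⟩ := LieAlgebra.ad_nilpotent_of_nilpotent (R := K) hQ
  obtain ⟨k, hk⟩ := LieAlgebra.ad_nilpotent_of_nilpotent (R := K) hΛ
  filter_upwards [Filter.eventually_ge_atTop i, Filter.eventually_ge_atTop j,
    Filter.eventually_ge_atTop k] with M hiM hjM hkM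
  have hlog : LieAlgebra.ad K A Λ =
      dynkinSum K M (wordProd (LieAlgebra.ad K A P) (LieAlgebra.ad K A Q)) := by
    rw [← aeval_exp_mul_exp_sub_one_logPoly (pow_eq_zero_of_le (by omega) hi)
      (pow_eq_zero_of_le (by omega) hj), exp_ad_mul_exp_ad hP hQ hΛ h,
      aeval_exp_sub_one_logPoly (pow_eq_zero_of_le hkM hk)]
  calc ⁅Λ, E⁆ = LinearMap.applyₗ (R := K) E (LieAlgebra.ad K A Λ) := rfl
    _ = dynkinSum K M fun l => -wordBracket P Q l := by
      rw [hlog, map_dynkinSum]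
      exact dynkinSum_congr fun l hl => wordProd_ad_apply hPE hQE hl
    _ = -dynkinSum K M (wordBracket P Q) := (map_dynkinSum K (-LinearMap.id) M _).symm

theorem exp_mul_exp_sub_one_pow_eq_zero {N : ℕ}
    (h : ∀ l : List Bool, N ≤ l.length → wordProd P Q l = 0) :
    P ^ N = 0 ∧ Q ^ N = 0 ∧ (IsNilpotent.exp P * IsNilpotent.exp Q - 1) ^ N = 0 := by
  have hP : P ^ N = 0 := by simpa [wordProd] using h (List.replicate N true) (by simp)
  have hQ : Q ^ N = 0 := by simpa [wordProd] using h (List.replicate N false) (by simp)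
  refine ⟨hP, hQ, ?_⟩
  rw [exp_mul_exp_sub_one (K := ℚ) (pow_eq_zero_of_le N.le_succ hP)
    (pow_eq_zero_of_le N.le_succ hQ), sum_pow_eq_sum_prod_ofFn]
  refine Finset.sum_eq_zero fun w hw => ?_
  rw [prod_ofFn_smul, h _ (le_length_word hw), smul_zero]

end Exp

section EulerOperator

variable {A : Type*} [Ring A] [Algebra K A]

/-- The Euler operator `X d/dX` on polynomials with coefficients in an algebra. -/
noncomputable def eulerOperator (A : Type*) [Ring A] [Algebra K A] : Module.End K A[X] where
  toFun f := X * derivative f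
  map_add' f g := by rw [derivative_add, mul_add]
  map_smul' c f := by rw [derivative_smul, mul_smul_comm]; rfl

theorem eulerOperator_apply (f : A[X]) : eulerOperator K A f = X * derivative f := rfl

theorem eulerOperator_C_mul_X_pow (a : A) (n : ℕ) :
    eulerOperator K A (C a * X ^ n) = (n : K) • (C a * X ^ n) := by
  rw [eulerOperator_apply, derivative_C_mul_X_pow]
  rcases n with _ | n
  · simp
  · rw [Nat.add_sub_cancel, X_mul, mul_assoc, ← pow_succ, Nat.cast_smul_eq_nsmul, nsmul_eq_mul',
      C_mul, C_eq_natCast, mul_assoc, mul_assoc, Nat.cast_comm]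

theorem lie_lmul_eulerOperator (f : A[X]) :
    ⁅Algebra.lmul K A[X] f, eulerOperator K A⁆ =
      -Algebra.lmul K A[X] (eulerOperator K A f) := by
  ext1 g
  simp only [LieRing.of_associative_ring_bracket, LinearMap.sub_apply, Module.End.mul_apply,
    eulerOperator_apply, Algebra.coe_lmul_eq_mul, LinearMap.mul_apply', LinearMap.neg_apply,
    derivative_mul, mul_add]
  rw [← mul_assoc f, ← X_mul, mul_assoc, mul_assoc]
  abel

theorem lie_lmul_C_mul_X_eulerOperator (a : A) :
    ⁅Algebra.lmul K A[X] (C a * X), eulerOperator K A⁆ = -Algebra.lmul K A[X] (C a * X) := by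
  have hfix := eulerOperator_C_mul_X_pow K a 1
  rw [pow_one, Nat.cast_one, one_smul] at hfix
  rw [lie_lmul_eulerOperator, hfix]

theorem lie_C_mul_X_pow (a b : A) (i j : ℕ) :
    ⁅C a * X ^ i, C b * X ^ j⁆ = C ⁅a, b⁆ * X ^ (i + j) := by
  have hmul (a b : A) (i j : ℕ) : C a * X ^ i * (C b * X ^ j) = C (a * b) * X ^ (i + j) := by
    rw [mul_assoc, ← mul_assoc (X ^ i), X_pow_mul, mul_assoc, ← mul_assoc, ← pow_add, C_mul]
  rw [LieRing.of_associative_ring_bracket, LieRing.of_associative_ring_bracket, hmul, hmul, C_sub,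
    sub_mul, add_comm j]

theorem wordBracket_C_mul_X (p q : A) (l : List Bool) :
    wordBracket (C p * X) (C q * X) l = C (wordBracket p q l) * X ^ l.length := by
  have hC (b : Bool) : cond b (C p * X) (C q * X) = C (cond b p q) * X := by cases b <;> rfl
  induction l with
  | nil => simp [wordBracket, nestedBracket]
  | cons b l ih =>
    rcases eq_or_ne l [] with rfl | hl
    · simp [wordBracket, nestedBracket, hC]
    · have hlie := lie_C_mul_X_pow (cond b p q) (wordBracket p q l) 1 l.length
      rw [wordBracket_cons _ _ _ hl, wordBracket_cons _ _ _ hl, ih, hC, List.length_cons,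
        add_comm _ 1, ← hlie, pow_one]

theorem isNilpotent_C_mul_X {a : A} (ha : IsNilpotent a) : IsNilpotent (C a * X) := by
  obtain ⟨k, hk⟩ := ha
  exact ⟨k, by rw [(commute_X (C a)).symm.mul_pow, ← C_pow, hk, C_0, zero_mul]⟩

theorem wordProd_C_mul_X (p q : A) (l : List Bool) :
    wordProd (C p * X) (C q * X) l = C (wordProd p q l) * X ^ l.length := by
  have hC (b : Bool) : cond b (C p * X) (C q * X) = C (cond b p q) * X := by cases b <;> rfl
  induction l with
  | nil => simp [wordProd]
  | cons b l ih =>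
    simp only [wordProd, List.map_cons, List.prod_cons, hC] at ih ⊢
    rw [ih, C_mul, List.length_cons, pow_succ', mul_assoc, mul_assoc, ← mul_assoc X, X_mul_C,
      mul_assoc]

theorem coeff_zero_dynkin_C_mul_X (M : ℕ) (p q : A) :
    (dynkin K M (C p * X) (C q * X)).coeff 0 = 0 := by
  change (lcoeff A 0).restrictScalars K (dynkin K M (C p * X) (C q * X)) = 0
  rw [dynkin, map_dynkinSum, dynkinSum_congr (d := 0)]
  · simp [dynkinSum]
  · intro l hl
    have hlen : 0 ≠ l.length := (List.length_pos_of_ne_nil hl).ne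
    simp [wordBracket_C_mul_X, coeff_X_pow, hlen]

variable [CharZero K]

theorem eulerOperator_dynkin (M : ℕ) (p q : A) :
    eulerOperator K A (dynkin K M (C p * X) (C q * X)) =
      dynkinSum K M (wordBracket (C p * X) (C q * X)) := by
  rw [dynkin, map_dynkinSum]
  refine dynkinSum_congr fun l hl => ?_
  have hlen : (l.length : K) ≠ 0 := by simpa using hl
  rw [map_smul, wordBracket_C_mul_X, eulerOperator_C_mul_X_pow, inv_smul_smul₀ hlen]

theorem eq_of_eulerOperator_eq {f g : A[X]} (h0 : f.coeff 0 = g.coeff 0)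
    (h : eulerOperator K A f = eulerOperator K A g) : f = g := by
  ext k
  rcases k with _ | k
  · exact h0
  · have hcoeff := congrArg (fun f => f.coeff (k + 1)) h
    simp only [eulerOperator_apply, coeff_X_mul, coeff_derivative, ← Nat.cast_succ,
      ← nsmul_eq_mul', ← Nat.cast_smul_eq_nsmul K] at hcoeff
    exact smul_right_injective A (Nat.cast_ne_zero.2 k.succ_ne_zero) hcoeff

variable {K} [Algebra ℚ A] {p q : A}

theorem eventually_eq_dynkin_C_mul_X {Λ : A[X]} (hp : IsNilpotent p) (hq : IsNilpotent q)
    (hΛ : IsNilpotent Λ) (hΛ0 : Λ.coeff 0 = 0)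
    (h : IsNilpotent.exp Λ = IsNilpotent.exp (C p * X) * IsNilpotent.exp (C q * X)) :
    ∀ᶠ M in Filter.atTop, Λ = dynkin K M (C p * X) (C q * X) := by
  let lmul := Algebra.lmul K A[X]
  have hP := isNilpotent_C_mul_X hp
  have hQ := isNilpotent_C_mul_X hq
  have hexp : IsNilpotent.exp (lmul Λ) =
      IsNilpotent.exp (lmul (C p * X)) * IsNilpotent.exp (lmul (C q * X)) := by
    rw [← IsNilpotent.map_exp hΛ, ← IsNilpotent.map_exp hP, ← IsNilpotent.map_exp hQ, h, map_mul]
  filter_upwards [lie_eq_neg_dynkinSum_wordBracket (K := K) (hP.map lmul) (hQ.map lmul)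
    (hΛ.map lmul) hexp (lie_lmul_C_mul_X_eulerOperator K p) (lie_lmul_C_mul_X_eulerOperator K q)]
    with M hM
  refine eq_of_eulerOperator_eq K (by rw [hΛ0, coeff_zero_dynkin_C_mul_X]) ?_
  rw [eulerOperator_dynkin]
  refine Algebra.lmul_injective (R := K) (neg_injective ?_)
  rw [← lie_lmul_eulerOperator, hM, ← AlgHom.coe_toLinearMap, map_dynkinSum]
  exact congrArg (fun c => -dynkinSum K M c)
    (funext fun l => (map_wordBracket lmul.toLieHom _ _ l).symm)

/-- Dynkin's form of the Baker–Campbell–Hausdorff formula. -/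
theorem exp_dynkin {N : ℕ} (h : ∀ l : List Bool, N ≤ l.length → wordProd p q l = 0) :
    ∀ᶠ M in Filter.atTop,
      IsNilpotent.exp (dynkin K M p q) = IsNilpotent.exp p * IsNilpotent.exp q := by
  obtain ⟨hp, hq, -⟩ := exp_mul_exp_sub_one_pow_eq_zero h
  obtain ⟨hP, hQ, hU⟩ := exp_mul_exp_sub_one_pow_eq_zero (P := C p * X) (Q := C q * X) (N := N)
    fun l hl => by rw [wordProd_C_mul_X, h l hl, C_0, zero_mul]
  set U := IsNilpotent.exp (C p * X) * IsNilpotent.exp (C q * X) - 1 with hUdef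
  set Λ := aeval U (logPoly N)
  have hΛ : IsNilpotent Λ := ⟨N, aeval_logPoly_pow_eq_zero hU⟩
  have hexp : IsNilpotent.exp Λ = IsNilpotent.exp (C p * X) * IsNilpotent.exp (C q * X) := by
    rw [exp_aeval_logPoly hU, hUdef, add_sub_cancel]
  have hΛ0 : Λ.coeff 0 = 0 := by
    change (constantCoeff (R := A)).toRatAlgHom Λ = 0
    rw [← aeval_algHom_apply, hUdef, map_sub, map_mul, IsNilpotent.map_exp ⟨N, hP⟩,
      IsNilpotent.map_exp ⟨N, hQ⟩]
    simp [aeval_zero_logPoly]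
  let evalOne : A[X] →ₐ[K] A := eval₂AlgHom (AlgHom.id K A) 1 fun _ => Commute.one_right _
  have hone (a : A) : evalOne (C a * X) = a := by simp [evalOne]
  filter_upwards [eventually_eq_dynkin_C_mul_X (K := K) ⟨N, hp⟩ ⟨N, hq⟩ hΛ hΛ0 hexp] with M hM
  have hdynkin : evalOne Λ = dynkin K M p q := by
    rw [hM]
    exact (map_dynkin evalOne.toLieHom M _ _).trans (congrArg₂ (dynkin K M) (hone p) (hone q))
  rw [← hdynkin, ← IsNilpotent.map_exp hΛ, hexp, map_mul, IsNilpotent.map_exp ⟨N, hP⟩,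
    IsNilpotent.map_exp ⟨N, hQ⟩, hone, hone]

end EulerOperator

end Dynkin

namespace Stratification

variable {V : Type*} [LieRing V] [LieAlgebra ℝ V] (S : Stratification V)

section Filtration

/-- The projection of `V` onto the layer `V_j`, as an endomorphism of `V`. -/
def proj (j : ℕ) : V →ₗ[ℝ] V where
  toFun v := (DirectSum.decompose S.layer v j : V)
  map_add' v w := by simp
  map_smul' c v := by rw [DirectSum.decompose_smul]; rfl

theorem proj_mem (j : ℕ) (v : V) : S.proj j v ∈ S.layer j :=
  (DirectSum.decompose S.layer v j).2

theorem proj_of_mem {j : ℕ} {v : V} (hv : v ∈ S.layer j) : S.proj j v = v :=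
  DirectSum.decompose_of_mem_same S.layer hv

theorem proj_of_mem_ne {i j : ℕ} {v : V} (hv : v ∈ S.layer i) (h : i ≠ j) : S.proj j v = 0 :=
  DirectSum.decompose_of_mem_ne S.layer hv h

theorem proj_of_step_lt {j : ℕ} (hj : S.step < j) (v : V) : S.proj j v = 0 := by
  simpa only [S.layer_of_step_lt j hj, Submodule.mem_bot] using S.proj_mem j v

theorem proj_zero_apply (v : V) : S.proj 0 v = 0 := by
  simpa only [S.layer_zero, Submodule.mem_bot] using S.proj_mem 0 v

theorem proj_proj (i j : ℕ) (v : V) : S.proj i (S.proj j v) = if i = j then S.proj i v else 0 := by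
  split_ifs with h
  · subst h; exact S.proj_of_mem (S.proj_mem _ _)
  · exact S.proj_of_mem_ne (S.proj_mem _ _) (Ne.symm h)

theorem proj_sum_of_mem {x : ℕ → V} (hx : ∀ i, x i ∈ S.layer i) (s : Finset ℕ) (j : ℕ) :
    S.proj j (∑ i ∈ s, x i) = if j ∈ s then x j else 0 := by
  have hproj (i : ℕ) : S.proj j (x i) = if j = i then x j else 0 := by
    split_ifs with h
    · subst h; exact S.proj_of_mem (hx j)
    · exact S.proj_of_mem_ne (hx i) (Ne.symm h)
  simp only [map_sum, hproj, Finset.sum_ite_eq]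

theorem sum_proj (v : V) : ∑ j ∈ Finset.range (S.step + 1), S.proj j v = v := by
  induction v using DirectSum.Decomposition.inductionOn S.layer with
  | zero => simp
  | @homogeneous i v =>
    rcases lt_or_ge S.step i with hi | hi
    · have hv : (v : V) = 0 := (Submodule.mem_bot ℝ).1 ((S.layer_of_step_lt i hi).le v.2)
      simp [hv]
    · rw [Finset.sum_eq_single_of_mem i (by simpa [Nat.lt_succ_iff] using hi), S.proj_of_mem v.2]
      exact fun j _ hj => S.proj_of_mem_ne v.2 hj.symm
  | add v w hv hw => simp only [map_add, Finset.sum_add_distrib, hv, hw]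

theorem ext_proj {v w : V} (h : ∀ j, S.proj j v = S.proj j w) : v = w := by
  rw [← S.sum_proj v, ← S.sum_proj w]
  exact Finset.sum_congr rfl fun j _ => h j

theorem proj_sum_smul_proj (c : ℕ → ℝ) (j : ℕ) (v : V) :
    S.proj j (∑ i ∈ Finset.range (S.step + 1), c i • S.proj i v) = c j • S.proj j v := by
  rw [S.proj_sum_of_mem fun i => (S.layer i).smul_mem (c i) (S.proj_mem i v)]
  split_ifs with hj
  · rfl
  · rw [S.proj_of_step_lt (by simpa using hj), smul_zero]

/-- The filtration `V_k ⊕ V_{k+1} ⊕ ⋯` of `V`. -/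
def fil (k : ℕ) : Submodule ℝ V := ⨅ i < k, LinearMap.ker (S.proj i)

theorem mem_fil {k : ℕ} {v : V} : v ∈ S.fil k ↔ ∀ i < k, S.proj i v = 0 := by
  simp only [fil, Submodule.mem_iInf, LinearMap.mem_ker]

theorem fil_anti : Antitone S.fil := fun _ _ h _ hv =>
  S.mem_fil.2 fun i hi => S.mem_fil.1 hv i (hi.trans_le h)

theorem layer_le_fil {j k : ℕ} (h : k ≤ j) : S.layer j ≤ S.fil k :=
  fun _ hv => S.mem_fil.2 fun _ hi => S.proj_of_mem_ne hv (hi.trans_le h).ne'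

theorem mem_fil_one (v : V) : v ∈ S.fil 1 :=
  S.mem_fil.2 fun _ hi => Nat.lt_one_iff.1 hi ▸ S.proj_zero_apply v

theorem eq_zero_of_mem_fil {k : ℕ} (hk : S.step < k) {v : V} (hv : v ∈ S.fil k) : v = 0 :=
  S.ext_proj fun j => by
    rw [map_zero]
    rcases lt_or_ge j k with hj | hj
    · exact S.mem_fil.1 hv j hj
    · exact S.proj_of_step_lt (hk.trans_le hj) v

theorem sub_mem_fil_succ {k : ℕ} {v w : V} (hv : v ∈ S.fil k) (hw : w ∈ S.fil k)
    (h : S.proj k v = S.proj k w) : v - w ∈ S.fil (k + 1) :=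
  S.mem_fil.2 fun i hi => by
    rw [map_sub, sub_eq_zero]
    rcases Nat.lt_succ_iff_lt_or_eq.1 hi with hi | rfl
    · rw [S.mem_fil.1 hv i hi, S.mem_fil.1 hw i hi]
    · exact h

theorem proj_eq_of_sub_mem_fil {k : ℕ} {v w : V} (h : v - w ∈ S.fil (k + 1)) :
    S.proj k v = S.proj k w := by
  rw [← sub_eq_zero, ← map_sub]
  exact S.mem_fil.1 h k k.lt_succ_self

theorem lie_mem_fil {a b : ℕ} {x y : V} (hx : x ∈ S.fil a) (hy : y ∈ S.fil b) :
    ⁅x, y⁆ ∈ S.fil (a + b) := by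
  rw [← S.sum_proj x, ← S.sum_proj y, sum_lie_sum]
  refine Submodule.sum_mem _ fun i _ => Submodule.sum_mem _ fun j _ => ?_
  by_cases hi : i < a
  · rw [S.mem_fil.1 hx i hi, zero_lie]; exact Submodule.zero_mem _
  by_cases hj : j < b
  · rw [S.mem_fil.1 hy j hj, lie_zero]; exact Submodule.zero_mem _
  exact S.layer_le_fil (by omega)
    (SetLike.GradedBracket.bracket_mem (S.proj_mem i x) (S.proj_mem j y))

theorem lie_mem_fil_right {k : ℕ} (x : V) {y : V} (hy : y ∈ S.fil k) : ⁅x, y⁆ ∈ S.fil (k + 1) :=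
  add_comm k 1 ▸ S.lie_mem_fil (S.mem_fil_one x) hy

theorem wordBracket_mem_fil_length (p q : V) (l : List Bool) :
    wordBracket p q l ∈ S.fil l.length := by
  induction l with
  | nil => exact Submodule.zero_mem _
  | cons b l ih =>
    rcases eq_or_ne l [] with rfl | hl
    · exact S.mem_fil_one _
    · rw [wordBracket_cons p q b hl]
      exact S.lie_mem_fil_right _ ih

theorem wordBracket_mem_fil {k : ℕ} {p q : V} (h : ⁅p, q⁆ ∈ S.fil k) (n : ℕ) {l : List Bool}
    (hl : l.length = n + 2) : wordBracket p q l ∈ S.fil (k + n) := by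
  induction n generalizing l with
  | zero =>
    obtain ⟨b, c, rfl⟩ := List.length_eq_two.1 hl
    rw [wordBracket_cons _ _ _ (List.cons_ne_nil _ _), add_zero]
    have hswap : ⁅q, p⁆ ∈ S.fil k := lie_skew q p ▸ Submodule.neg_mem _ h
    cases b <;> cases c <;> simp [wordBracket, nestedBracket, h, hswap]
  | succ n ih =>
    obtain ⟨b, l, rfl⟩ := List.exists_cons_of_length_eq_add_one hl
    have hlen : l.length = n + 2 := Nat.succ_injective hl
    rw [wordBracket_cons _ _ _ (List.ne_nil_of_length_eq_add_one hlen)]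
    exact S.lie_mem_fil_right _ (ih hlen)

theorem wordBracket_sub_mem_fil {k : ℕ} {p p' : V} (h : p - p' ∈ S.fil k) (q : V) (n : ℕ)
    {l : List Bool} (hl : l.length = n + 1) :
    wordBracket p q l - wordBracket p' q l ∈ S.fil (k + n) := by
  have hletter (b : Bool) : cond b p q - cond b p' q ∈ S.fil k := by cases b <;> simp [h]
  induction n generalizing l with
  | zero =>
    obtain ⟨b, rfl⟩ := List.length_eq_one_iff.1 hl
    exact hletter b
  | succ n ih =>
    obtain ⟨b, l, rfl⟩ := List.exists_cons_of_length_eq_add_one hl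
    have hlen : l.length = n + 1 := Nat.succ_injective hl
    have hne := List.ne_nil_of_length_eq_add_one hlen
    rw [wordBracket_cons _ _ _ hne, wordBracket_cons _ _ _ hne]
    have hsplit : ⁅cond b p q, wordBracket p q l⁆ - ⁅cond b p' q, wordBracket p' q l⁆ =
        ⁅cond b p q, wordBracket p q l - wordBracket p' q l⁆ +
          ⁅cond b p q - cond b p' q, wordBracket p' q l⁆ := by
      rw [lie_sub, sub_lie]; abel
    rw [hsplit]
    exact Submodule.add_mem _ (S.lie_mem_fil_right _ (ih hlen))
      (S.lie_mem_fil (hletter b) (hlen ▸ S.wordBracket_mem_fil_length p' q l))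

end Filtration

section GroupLaw

theorem mul_eq_dynkin {M : ℕ} (hM : S.step ≤ M) (p q : V) : S.mul p q = dynkin ℝ M p q := by
  have hvanish (l : List Bool) (hl : S.step < l.length) :
      (l.length : ℝ)⁻¹ • wordBracket p q l = 0 := by
    rw [wordBracket, S.nestedBracket_eq_zero _ (by simpa using hl), smul_zero]
  rw [dynkin, dynkinSum_eq_of_le hvanish hM]
  simp only [mul, dynkinSum, wordBracket, word_map, length_word, smul_smul, mul_inv_rev]
  rfl

theorem mul_sub_mem_fil {k : ℕ} {p q : V} (h : ⁅p, q⁆ ∈ S.fil k) :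
    S.mul p q - (p + q + (2 : ℝ)⁻¹ • ⁅p, q⁆) ∈ S.fil (k + 1) := by
  rw [S.mul_eq_dynkin (Nat.le_add_right S.step 2), dynkin]
  have hmem := dynkinSum_sub_mem (M := S.step + 2) (S.fil (k + 1))
    (c := fun l => (l.length : ℝ)⁻¹ • wordBracket p q l) (fun l hl => Submodule.smul_mem _ _
      (S.fil_anti (by omega) (S.wordBracket_mem_fil h (l.length - 2) (by omega)))) (by omega)
  convert hmem using 2
  simp only [wordBracket, nestedBracket, List.map_cons, List.map_nil, cond_true, cond_false,
    List.length_cons, List.length_nil, ← lie_skew p q]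
  module

theorem mul_sub_add_mem_fil {k : ℕ} {p q : V} (h : ⁅p, q⁆ ∈ S.fil k) :
    S.mul p q - (p + q) ∈ S.fil k := by
  convert Submodule.add_mem _ (S.fil_anti k.le_succ (S.mul_sub_mem_fil h))
    (Submodule.smul_mem _ (2 : ℝ)⁻¹ h) using 1
  abel

theorem mul_of_lie_eq_zero {p q : V} (h : ⁅p, q⁆ = 0) : S.mul p q = p + q :=
  sub_eq_zero.1 <| S.eq_zero_of_mem_fil S.step.lt_succ_self <|
    S.mul_sub_add_mem_fil (h ▸ Submodule.zero_mem _)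

theorem mul_zero (p : V) : S.mul p 0 = p := by
  rw [S.mul_of_lie_eq_zero (lie_zero p), add_zero]

theorem zero_mul (p : V) : S.mul 0 p = p := by
  rw [S.mul_of_lie_eq_zero (zero_lie p), zero_add]

theorem neg_mul_self (p : V) : S.mul (-p) p = 0 := by
  rw [S.mul_of_lie_eq_zero (by simp), neg_add_cancel]

theorem mul_neg_self (p : V) : S.mul p (-p) = 0 := by
  rw [S.mul_of_lie_eq_zero (by simp), add_neg_cancel]

theorem smul_mul_smul (a b : ℝ) (x : V) : S.mul (a • x) (b • x) = (a + b) • x := by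
  rw [S.mul_of_lie_eq_zero (by simp), add_smul]

theorem mul_sub_mul_mem_fil {k : ℕ} {p p' : V} (h : p - p' ∈ S.fil k) (q : V) :
    S.mul p q - S.mul p' q - (p - p') ∈ S.fil (k + 1) := by
  have hbracket {l : List Bool} (hl : 2 ≤ l.length) :
      (l.length : ℝ)⁻¹ • wordBracket p q l - (l.length : ℝ)⁻¹ • wordBracket p' q l ∈
        S.fil (k + 1) := by
    rw [← smul_sub]
    exact Submodule.smul_mem _ _
      (S.fil_anti (by omega) (S.wordBracket_sub_mem_fil h q (l.length - 1) (by omega)))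
  have hM := Nat.le_add_right S.step 2
  rw [S.mul_eq_dynkin hM, S.mul_eq_dynkin hM, dynkin, dynkin, ← dynkinSum_sub]
  convert Submodule.add_mem _ (dynkinSum_sub_mem (M := S.step + 2) (S.fil (k + 1))
    (c := fun l => (l.length : ℝ)⁻¹ • wordBracket p q l - (l.length : ℝ)⁻¹ • wordBracket p' q l)
    (fun l hl => hbracket (by omega)) (by omega)) (Submodule.smul_mem _ (2 : ℝ)⁻¹
      (Submodule.sub_mem _ (hbracket (l := [true, false]) (by simp))
        (hbracket (l := [false, true]) (by simp)))) using 1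
  simp only [wordBracket, nestedBracket, List.map_cons, List.map_nil, cond_true, cond_false,
    List.length_cons, List.length_nil]
  module

theorem proj_mul_sub {j : ℕ} {p p' : V} (h : ∀ i < j, S.proj i p = S.proj i p') (q : V) :
    S.proj j (S.mul p q) - S.proj j p = S.proj j (S.mul p' q) - S.proj j p' := by
  have hp : p - p' ∈ S.fil j := S.mem_fil.2 fun i hi => by rw [map_sub, h i hi, sub_self]
  rw [sub_eq_sub_iff_sub_eq_sub, ← map_sub, ← map_sub]
  exact S.proj_eq_of_sub_mem_fil (S.mul_sub_mul_mem_fil hp q)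

end GroupLaw

section Representation

attribute [local instance] LieRing.ofAssociativeRing

/-- The derivation of `V` that multiplies the layer `V_j` by `j`. -/
def gradeDerivation : LieDerivation ℝ V V :=
  LieDerivation.ofGrading S.layer (Nat.castAddMonoidHom ℝ)

theorem gradeDerivation_apply (v : V) :
    S.gradeDerivation v = ∑ j ∈ Finset.range (S.step + 1), (j : ℝ) • S.proj j v := by
  conv_lhs => rw [← S.sum_proj v, map_sum]
  exact Finset.sum_congr rfl fun j _ =>
    LieDerivation.ofGrading_apply_apply S.layer _ (S.proj_mem j v)

theorem eq_zero_of_gradeDerivation_eq_zero {v : V} (h : S.gradeDerivation v = 0) : v = 0 := by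
  refine S.ext_proj fun i => ?_
  rw [map_zero]
  rcases Nat.eq_zero_or_pos i with rfl | hi
  · exact S.proj_zero_apply v
  · have hproj := S.proj_sum_smul_proj (fun j => (j : ℝ)) i v
    rw [← gradeDerivation_apply, h, map_zero, eq_comm, smul_eq_zero] at hproj
    exact hproj.resolve_left (Nat.cast_ne_zero.2 hi.ne')

/-- The adjoint action of `V` on its extension `V × ℝ` by the grading derivation. Unlike the
adjoint action on `V` itself it is faithful, and it is still nilpotent. -/
def rep : V →ₗ⁅ℝ⁆ Module.End ℝ (V × ℝ) where
  toFun v := LinearMap.inl ℝ V ℝ ∘ₗ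
    (LieAlgebra.ad ℝ V v).coprod (-LinearMap.toSpanSingleton ℝ V (S.gradeDerivation v))
  map_add' v w := by
    refine LinearMap.ext fun x => Prod.ext ?_ (by simp)
    simp only [map_add, LinearMap.coe_comp, LinearMap.coe_inl, Function.comp_apply,
      LinearMap.coprod_apply, LinearMap.add_apply, LieAlgebra.ad_apply, LinearMap.neg_apply,
      LinearMap.toSpanSingleton_apply, smul_add, neg_add_rev, Prod.mk_add_mk]
    abel
  map_smul' c v := by
    refine LinearMap.ext fun x => Prod.ext ?_ (by simp)
    simp [smul_comm c]
  map_lie' {v w} := by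
    refine LinearMap.ext fun x => Prod.ext ?_ (by simp [LieRing.of_associative_ring_bracket])
    simp only [LieHom.map_lie, LieRing.of_associative_ring_bracket,
      LieDerivation.apply_lie_eq_sub, LinearMap.coe_comp, LinearMap.coe_inl, Function.comp_apply,
      LinearMap.coprod_apply, LinearMap.sub_apply, Module.End.mul_apply, LieAlgebra.ad_apply,
      LinearMap.neg_apply, LinearMap.toSpanSingleton_apply, smul_sub, neg_sub, lie_add, lie_neg,
      lie_smul, zero_smul, neg_zero, add_zero, Prod.mk_sub_mk]
    abel

theorem rep_apply (v : V) (x : V × ℝ) :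
    S.rep v x = (⁅v, x.1⁆ - x.2 • S.gradeDerivation v, 0) := by
  simp [rep, sub_eq_add_neg]

theorem rep_injective : Function.Injective S.rep := by
  refine (injective_iff_map_eq_zero _).2 fun v hv => S.eq_zero_of_gradeDerivation_eq_zero ?_
  simpa [rep_apply] using LinearMap.congr_fun hv (0, 1)

/-- The filtration of `V × ℝ` that extends `fil`, the derivation being given degree `0`. -/
def repFil : ℕ → Submodule ℝ (V × ℝ)
  | 0 => ⊤
  | k + 1 => (S.fil (k + 1)).prod ⊥

theorem rep_mem_repFil (v : V) {k : ℕ} {x : V × ℝ} (hx : x ∈ S.repFil k) :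
    S.rep v x ∈ S.repFil (k + 1) := by
  rw [rep_apply]
  refine ⟨?_, rfl⟩
  rcases k with _ | k
  · exact S.mem_fil_one _
  · obtain ⟨hx1, hx2⟩ := hx
    simpa [(Submodule.mem_bot ℝ).1 hx2] using S.lie_mem_fil_right v hx1

theorem wordProd_rep_mem_repFil (v w : V) (l : List Bool) (x : V × ℝ) :
    wordProd (S.rep v) (S.rep w) l x ∈ S.repFil l.length := by
  induction l with
  | nil => trivial
  | cons b l ih =>
    cases b
    · exact S.rep_mem_repFil w ih
    · exact S.rep_mem_repFil v ih

theorem wordProd_rep_eq_zero (v w : V) {l : List Bool} (hl : S.step + 1 ≤ l.length) :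
    wordProd (S.rep v) (S.rep w) l = 0 := by
  refine LinearMap.ext fun x => ?_
  obtain ⟨n, hn⟩ := Nat.exists_eq_succ_of_ne_zero (Nat.ne_zero_of_lt hl)
  have hmem := S.wordProd_rep_mem_repFil v w l x
  rw [hn] at hmem
  exact Prod.ext (S.eq_zero_of_mem_fil (by omega) hmem.1) hmem.2

/-- The rational algebra structure underlying a real algebra, over which `IsNilpotent.exp` is
defined. -/
noncomputable abbrev ratAlgebra (A : Type*) [Ring A] [Algebra ℝ A] : Algebra ℚ A :=
  Algebra.compHom A (algebraMap ℚ ℝ)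

attribute [local instance] ratAlgebra

theorem isNilpotent_rep (v : V) : IsNilpotent (S.rep v) :=
  ⟨S.step + 1,
    (exp_mul_exp_sub_one_pow_eq_zero fun _ hl => S.wordProd_rep_eq_zero v v hl).1⟩

theorem exp_rep_mul (p q : V) : IsNilpotent.exp (S.rep (S.mul p q)) =
    IsNilpotent.exp (S.rep p) * IsNilpotent.exp (S.rep q) := by
  obtain ⟨M, hexp, hM⟩ := ((exp_dynkin (K := ℝ) fun _ hl => S.wordProd_rep_eq_zero p q hl).and
    (eventually_ge_atTop S.step)).exists
  rw [S.mul_eq_dynkin hM, map_dynkin, hexp]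

theorem eq_of_exp_rep_eq {p q : V}
    (h : IsNilpotent.exp (S.rep p) = IsNilpotent.exp (S.rep q)) : p = q :=
  S.rep_injective (exp_injective_of_isNilpotent (S.isNilpotent_rep p) (S.isNilpotent_rep q) h)

theorem mul_assoc (p q r : V) : S.mul (S.mul p q) r = S.mul p (S.mul q r) :=
  S.eq_of_exp_rep_eq (by simp only [exp_rep_mul, _root_.mul_assoc])

end Representation

theorem neg_mul_cancel_left (p q : V) : S.mul (-p) (S.mul p q) = q := by
  rw [← S.mul_assoc, S.neg_mul_self, S.zero_mul]

theorem mul_neg_cancel_left (p q : V) : S.mul p (S.mul (-p) q) = q := by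
  rw [← S.mul_assoc, S.mul_neg_self, S.zero_mul]

theorem neg_mul_rev (p q : V) : -S.mul p q = S.mul (-q) (-p) := by
  have hprod : S.mul (S.mul p q) (S.mul (-q) (-p)) = 0 := by
    rw [S.mul_assoc, S.mul_neg_cancel_left, S.mul_neg_self]
  rw [← S.mul_zero (-S.mul p q), ← hprod, S.neg_mul_cancel_left]

theorem neg_mul_mul_neg_mul (a b c : V) : S.mul (S.mul (-a) b) (S.mul (-b) c) = S.mul (-a) c := by
  rw [S.mul_assoc, S.mul_neg_cancel_left]

theorem mul_sub_mul_swap_mem_fil {k : ℕ} {p q : V} (h : ⁅p, q⁆ ∈ S.fil k) :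
    S.mul p q - S.mul q p - ⁅p, q⁆ ∈ S.fil (k + 1) := by
  have hswap : ⁅q, p⁆ ∈ S.fil k := lie_skew q p ▸ Submodule.neg_mem _ h
  convert Submodule.sub_mem _ (S.mul_sub_mem_fil h) (S.mul_sub_mem_fil hswap) using 1
  rw [← lie_skew p q]
  module

theorem commutator_sub_mem_fil {k : ℕ} (a : V) {g : V} (hg : g ∈ S.fil k) :
    S.mul (S.mul (S.mul a g) (-a)) (-g) - ⁅a, g⁆ ∈ S.fil (k + 2) := by
  set x := S.mul a g
  set y := S.mul g a with hy
  have hcomm : S.mul (S.mul x (-a)) (-g) = S.mul x (-y) := by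
    rw [S.mul_assoc, hy, S.neg_mul_rev]
  have hag := S.lie_mem_fil_right a hg
  have hswap : x - y - ⁅a, g⁆ ∈ S.fil (k + 2) := S.mul_sub_mul_swap_mem_fil hag
  have hxy : x - y ∈ S.fil (k + 1) := by
    simpa using Submodule.add_mem _ (S.fil_anti (Nat.le_succ _) hswap) hag
  have hlie : ⁅x, -y⁆ ∈ S.fil (k + 2) := by
    simpa using S.lie_mem_fil_right x hxy
  rw [hcomm]
  convert Submodule.add_mem _ (S.mul_sub_add_mem_fil hlie) hswap using 1
  abel

end Stratification

namespace Stratification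

variable {V : Type*} [LieRing V] [LieAlgebra ℝ V] (S : Stratification V)
  {V' : Type*} [LieRing V'] [LieAlgebra ℝ V'] (S' : Stratification V')

theorem map_mul (φ : V →ₗ⁅ℝ⁆ V') (p q : V) : φ (S.mul p q) = S'.mul (φ p) (φ q) := by
  rw [S.mul_eq_dynkin (le_max_left S.step S'.step),
    S'.mul_eq_dynkin (le_max_right S.step S'.step), map_dynkin]

theorem proj_dilation (j : ℕ) (t : ℝ) (v : V) : S.proj j (S.dilation t v) = t ^ j • S.proj j v :=
  S.proj_sum_smul_proj (fun i => t ^ i) j v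

theorem dilation_add (t : ℝ) (v w : V) : S.dilation t (v + w) = S.dilation t v + S.dilation t w :=
  S.ext_proj fun j => by simp only [proj_dilation, map_add, smul_add]

theorem dilation_smul (t c : ℝ) (v : V) : S.dilation t (c • v) = c • S.dilation t v :=
  S.ext_proj fun j => by simp only [proj_dilation, map_smul, smul_comm c]

theorem dilation_of_mem {j : ℕ} {v : V} (hv : v ∈ S.layer j) (t : ℝ) :
    S.dilation t v = t ^ j • v :=
  S.ext_proj fun i => by
    rw [proj_dilation, map_smul]
    rcases eq_or_ne j i with rfl | h
    · rfl
    · rw [S.proj_of_mem_ne hv h, smul_zero, smul_zero]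

/-- The dilation as a linear map. -/
def dilationLinearMap (t : ℝ) : V →ₗ[ℝ] V where
  toFun := S.dilation t
  map_add' := S.dilation_add t
  map_smul' := S.dilation_smul t

/-- The dilation as a morphism of Lie algebras. -/
def dilationHom (t : ℝ) : V →ₗ⁅ℝ⁆ V where
  toLinearMap := S.dilationLinearMap t
  map_lie' {x y} := by
    change S.dilationLinearMap t ⁅x, y⁆ = ⁅S.dilationLinearMap t x, S.dilationLinearMap t y⁆
    rw [← S.sum_proj x, ← S.sum_proj y, sum_lie_sum]
    simp only [map_sum, sum_lie_sum]
    refine Finset.sum_congr rfl fun i _ => Finset.sum_congr rfl fun j _ => ?_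
    have hij := SetLike.GradedBracket.bracket_mem (S.proj_mem i x) (S.proj_mem j y)
    simp only [dilationLinearMap, LinearMap.coe_mk, AddHom.coe_mk, S.dilation_of_mem hij,
      S.dilation_of_mem (S.proj_mem _ _), smul_lie, lie_smul, smul_smul, pow_add,
      mul_comm (t ^ i)]

theorem dilation_mul (t : ℝ) (p q : V) :
    S.dilation t (S.mul p q) = S.mul (S.dilation t p) (S.dilation t q) :=
  S.map_mul S (S.dilationHom t) p q

theorem dilation_neg (t : ℝ) (p : V) : S.dilation t (-p) = -S.dilation t p :=
  map_neg (S.dilationHom t) p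

theorem dilation_zero (t : ℝ) : S.dilation t 0 = 0 := map_zero (S.dilationHom t)

theorem dilation_dilation (s t : ℝ) (v : V) :
    S.dilation s (S.dilation t v) = S.dilation (s * t) v :=
  S.ext_proj fun j => by simp only [proj_dilation, smul_smul, mul_pow]

theorem dilation_one (v : V) : S.dilation 1 v = v :=
  S.ext_proj fun j => by simp only [proj_dilation, one_pow, one_smul]

theorem zero_dilation (v : V) : S.dilation 0 v = 0 :=
  S.ext_proj fun j => by
    rw [proj_dilation, map_zero]
    rcases Nat.eq_zero_or_pos j with rfl | hj
    · rw [S.proj_zero_apply, smul_zero]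
    · rw [zero_pow hj.ne', zero_smul]

theorem dilation_inv_dilation {t : ℝ} (ht : t ≠ 0) (v : V) :
    S.dilation t⁻¹ (S.dilation t v) = v := by
  rw [dilation_dilation, inv_mul_cancel₀ ht, dilation_one]

theorem dilation_dilation_inv {t : ℝ} (ht : t ≠ 0) (v : V) :
    S.dilation t (S.dilation t⁻¹ v) = v := by
  rw [dilation_dilation, mul_inv_cancel₀ ht, dilation_one]

end Stratification

namespace HomogeneousHom

variable {V V' : Type*} [LieRing V] [LieAlgebra ℝ V] [LieRing V'] [LieAlgebra ℝ V']
  {S : Stratification V} {S' : Stratification V'} (L : HomogeneousHom S S')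

theorem proj_apply (j : ℕ) (v : V) : S'.proj j (L.toLieHom v) = L.toLieHom (S.proj j v) := by
  conv_lhs => rw [← S.sum_proj v, map_sum]
  rw [S'.proj_sum_of_mem fun i => L.map_layer i _ (S.proj_mem i v)]
  split_ifs with hj
  · rfl
  · rw [S.proj_of_step_lt (by simpa using hj), map_zero]

theorem map_dilation (t : ℝ) (v : V) :
    L.toLieHom (S.dilation t v) = S'.dilation t (L.toLieHom v) :=
  S'.ext_proj fun j => by
    rw [S'.proj_dilation, proj_apply, proj_apply, S.proj_dilation, map_smul]

theorem map_mul (p q : V) :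
    L.toLieHom (S.mul p q) = S'.mul (L.toLieHom p) (L.toLieHom q) :=
  S.map_mul S' L.toLieHom p q

end HomogeneousHom

namespace Stratification

variable {V : Type*} [LieRing V] [LieAlgebra ℝ V]

section Coordinates

variable {E : Type*} [NormedAddCommGroup E] [NormedSpace ℝ E] [FiniteDimensional ℝ E]
  (e : V ≃ₗ[ℝ] E) {r : WithTop ℕ∞}

theorem contDiff_lie_coordinates :
    ContDiff ℝ r fun x : E × E => e ⁅e.symm x.1, e.symm x.2⁆ := by
  have hbilin : IsBilinearMap ℝ fun x y : E => e ⁅e.symm x, e.symm y⁆ := by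
    constructor <;> intros <;> simp
  exact hbilin.toContinuousBilinearMap.isBoundedBilinearMap.contDiff

theorem contDiff_wordBracket_coordinates (l : List Bool) :
    ContDiff ℝ r fun x : E × E => e (wordBracket (e.symm x.1) (e.symm x.2) l) := by
  have hletter (b : Bool) : ContDiff ℝ r fun x : E × E => e (cond b (e.symm x.1) (e.symm x.2)) := by
    cases b
    · simpa only [cond_false, LinearEquiv.apply_symm_apply] using contDiff_snd
    · simpa only [cond_true, LinearEquiv.apply_symm_apply] using contDiff_fst
  induction l with
  | nil => simpa only [wordBracket, List.map_nil, nestedBracket] using contDiff_const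
  | cons b l ih =>
    rcases eq_or_ne l [] with rfl | hl
    · exact hletter b
    · simpa only [wordBracket_cons _ _ b hl, Function.comp_def, LinearEquiv.symm_apply_apply]
        using (contDiff_lie_coordinates e).comp ((hletter b).prodMk ih)

theorem contDiff_mul_coordinates (S : Stratification V) :
    ContDiff ℝ r fun x : E × E => e (S.mul (e.symm x.1) (e.symm x.2)) := by
  simp only [S.mul_eq_dynkin le_rfl, dynkin, dynkinSum, map_sum, map_smul]
  refine ContDiff.sum fun n _ => ContDiff.const_smul _ (ContDiff.sum fun w _ => ?_)
  exact ContDiff.const_smul _ (ContDiff.const_smul _ (contDiff_wordBracket_coordinates e _))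

end Coordinates

section Topology

variable [FiniteDimensional ℝ V] [TopologicalSpace V] [IsTopologicalAddGroup V]
  [ContinuousSMul ℝ V] [T2Space V]

theorem continuous_mul (S : Stratification V) : Continuous fun x : V × V => S.mul x.1 x.2 := by
  let e := (Module.finBasis ℝ V).equivFun.toContinuousLinearEquiv
  have hcoord := (S.contDiff_mul_coordinates e.toLinearEquiv (r := 0)).continuous
  simpa [Function.comp_def] using
    e.symm.continuous.comp (hcoord.comp (e.continuous.prodMap e.continuous))

theorem continuous_proj (S : Stratification V) (j : ℕ) : Continuous (S.proj j) :=
  LinearMap.continuous_of_finiteDimensional _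

theorem continuous_dilation (S : Stratification V) :
    Continuous fun x : ℝ × V => S.dilation x.1 x.2 :=
  continuous_finsetSum _ fun j _ =>
    (continuous_fst.pow j).smul ((S.continuous_proj j).comp continuous_snd)

variable {S : Stratification V} {ι : Type*} {F : Filter ι}

theorem tendsto_mul {u v : ι → V} {u₀ v₀ : V} (hu : Tendsto u F (𝓝 u₀))
    (hv : Tendsto v F (𝓝 v₀)) : Tendsto (fun n => S.mul (u n) (v n)) F (𝓝 (S.mul u₀ v₀)) := by
  simpa only [Function.comp_def] using
    (S.continuous_mul.tendsto (u₀, v₀)).comp (hu.prodMk_nhds hv)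

theorem tendsto_dilation {t : ι → ℝ} {v : ι → V} {t₀ : ℝ} {v₀ : V} (ht : Tendsto t F (𝓝 t₀))
    (hv : Tendsto v F (𝓝 v₀)) :
    Tendsto (fun n => S.dilation (t n) (v n)) F (𝓝 (S.dilation t₀ v₀)) := by
  simpa only [Function.comp_def] using
    (S.continuous_dilation.tendsto (t₀, v₀)).comp (ht.prodMk_nhds hv)

end Topology

section HorizontalGeneration

variable {S : Stratification V} {ι : Type*} {F : Filter ι}
  {P : Set (ι → V)}

/-- A set of families in `V`, closed under products and inverses, that contains the families
along fixed horizontal directions with convergent coefficients. -/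
structure IsHorizontalSubgroup (S : Stratification V) (F : Filter ι) (P : Set (ι → V)) :
    Prop where
  mul_mem : ∀ u ∈ P, ∀ w ∈ P, (fun n => S.mul (u n) (w n)) ∈ P
  neg_mem : ∀ u ∈ P, (fun n => -u n) ∈ P
  smul_mem : ∀ a ∈ S.layer 1, ∀ (c : ι → ℝ) (c₀ : ℝ), Tendsto c F (𝓝 c₀) →
    (fun n => c n • a) ∈ P

theorem IsHorizontalSubgroup.zero_mem (hP : IsHorizontalSubgroup S F P) :
    (fun _ => (0 : V)) ∈ P := by
  simpa only [smul_zero] using hP.smul_mem 0 (Submodule.zero_mem _) (fun _ => 0) 0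
    tendsto_const_nhds

theorem IsHorizontalSubgroup.const_mem (hP : IsHorizontalSubgroup S F P) {a : V}
    (ha : a ∈ S.layer 1) : (fun _ => a) ∈ P := by
  simpa only [one_smul] using hP.smul_mem a ha (fun _ => 1) 1 tendsto_const_nhds

variable [TopologicalSpace V]

/-- The family `x` consists of the components of degree `k` of a convergent family in `P` whose
components of smaller degree vanish. -/
def IsLeadingPart (S : Stratification V) (F : Filter ι) (P : Set (ι → V)) (k : ℕ)
    (x : ι → V) : Prop :=
  ∃ g ∈ P, (∃ g₀, Tendsto g F (𝓝 g₀)) ∧ ∀ n, g n ∈ S.fil k ∧ S.proj k (g n) = x n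

namespace IsHorizontalSubgroup

theorem isLeadingPart_zero (hP : IsHorizontalSubgroup S F P) (k : ℕ) :
    IsLeadingPart S F P k fun _ => 0 :=
  ⟨_, hP.zero_mem, ⟨0, tendsto_const_nhds⟩, fun _ => ⟨Submodule.zero_mem _, map_zero _⟩⟩

variable [FiniteDimensional ℝ V] [IsTopologicalAddGroup V] [ContinuousSMul ℝ V] [T2Space V]

theorem isLeadingPart_add (hP : IsHorizontalSubgroup S F P) {k : ℕ} {x y : ι → V}
    (hx : IsLeadingPart S F P k x) (hy : IsLeadingPart S F P k y) :
    IsLeadingPart S F P k fun n => x n + y n := by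
  obtain ⟨g, hgP, ⟨g₀, hg₀⟩, hg⟩ := hx
  obtain ⟨g', hgP', ⟨g₀', hg₀'⟩, hg'⟩ := hy
  refine ⟨_, hP.mul_mem _ hgP _ hgP', ⟨_, tendsto_mul hg₀ hg₀'⟩, fun n => ?_⟩
  have hsub := S.mul_sub_add_mem_fil (S.lie_mem_fil_right (g n) (hg' n).1)
  refine ⟨(Submodule.sub_mem_iff_left _ (Submodule.add_mem _ (hg n).1 (hg' n).1)).1
    (S.fil_anti k.le_succ hsub), ?_⟩
  rw [S.proj_eq_of_sub_mem_fil hsub, map_add, (hg n).2, (hg' n).2]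

/-- Modulo elements of higher degree, the group commutator is the Lie bracket. -/
theorem isLeadingPart_lie (hP : IsHorizontalSubgroup S F P) {k : ℕ} {x : ι → V} {a : V}
    (ha : a ∈ S.layer 1) (hx : IsLeadingPart S F P k x) :
    IsLeadingPart S F P (k + 1) fun n => ⁅a, x n⁆ := by
  obtain ⟨g, hgP, ⟨g₀, hg₀⟩, hg⟩ := hx
  have haP := hP.const_mem ha
  refine ⟨_, hP.mul_mem _ (hP.mul_mem _ (hP.mul_mem _ haP _ hgP) _ (hP.neg_mem _ haP)) _
    (hP.neg_mem _ hgP), ⟨_, tendsto_mul (tendsto_mul (tendsto_mul tendsto_const_nhds hg₀)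
      tendsto_const_nhds) hg₀.neg⟩, fun n => ?_⟩
  have hsub := S.commutator_sub_mem_fil a (hg n).1
  have hproj : S.proj k (g n) ∈ S.layer k := S.proj_mem k (g n)
  refine ⟨(Submodule.sub_mem_iff_left _ (S.lie_mem_fil_right a (hg n).1)).1
    (S.fil_anti (Nat.le_succ _) hsub), ?_⟩
  have hlie : ⁅a, g n⁆ - ⁅a, S.proj k (g n)⁆ ∈ S.fil (k + 2) := by
    rw [← lie_sub]
    exact S.lie_mem_fil_right a (S.sub_mem_fil_succ (hg n).1 (S.layer_le_fil le_rfl hproj)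
      (S.proj_of_mem hproj).symm)
  rw [S.proj_eq_of_sub_mem_fil hsub, S.proj_eq_of_sub_mem_fil hlie,
    S.proj_of_mem (add_comm 1 k ▸ SetLike.GradedBracket.bracket_mem ha hproj), (hg n).2]

theorem isLeadingPart_smul (hP : IsHorizontalSubgroup S F P) {k : ℕ} (hk : 1 ≤ k) {w : V}
    (hw : w ∈ S.layer k) {c : ι → ℝ} {c₀ : ℝ} (hc : Tendsto c F (𝓝 c₀)) :
    IsLeadingPart S F P k fun n => c n • w := by
  induction k, hk using Nat.le_induction generalizing w c c₀ with
  | base =>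
    have hmem (n : ι) : c n • w ∈ S.layer 1 := (S.layer 1).smul_mem (c n) hw
    exact ⟨_, hP.smul_mem w hw c c₀ hc, ⟨_, hc.smul_const w⟩,
      fun n => ⟨S.mem_fil_one _, S.proj_of_mem (hmem n)⟩⟩
  | succ k hk ih =>
    rw [← S.span_bracket k hk] at hw
    induction hw using Submodule.span_induction generalizing c c₀ with
    | mem x hx =>
      obtain ⟨a, ha, w, hw, rfl⟩ := hx
      simpa only [lie_smul] using hP.isLeadingPart_lie ha (ih hw hc)
    | zero => simpa only [smul_zero] using hP.isLeadingPart_zero (k + 1)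
    | add x y _ _ ihx ihy =>
      simpa only [smul_add] using hP.isLeadingPart_add (ihx hc) (ihy hc)
    | smul r x _ ihx => simpa only [smul_smul] using ihx (hc.mul_const r)

theorem isLeadingPart_proj (hP : IsHorizontalSubgroup S F P) {k : ℕ} (hk : 1 ≤ k) {u : ι → V}
    {u₀ : V} (hu : Tendsto u F (𝓝 u₀)) : IsLeadingPart S F P k fun n => S.proj k (u n) := by
  let b := Module.finBasis ℝ (S.layer k)
  let π : V →ₗ[ℝ] S.layer k := (S.proj k).codRestrict (S.layer k) (S.proj_mem k)
  let coord i : V →ₗ[ℝ] ℝ := b.coord i ∘ₗ π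
  have hcoord i : Tendsto (fun n => coord i (u n)) F (𝓝 (coord i u₀)) :=
    ((LinearMap.continuous_of_finiteDimensional (coord i)).tendsto u₀).comp hu
  have hexpand (v : V) : S.proj k v = ∑ i, coord i v • (b i : V) := by
    have hv := congrArg (S.layer k).subtype (b.sum_repr (π v))
    rw [map_sum] at hv
    exact hv.symm
  simp only [hexpand]
  induction (Finset.univ : Finset (Fin (Module.finrank ℝ (S.layer k)))) using
    Finset.cons_induction with
  | empty => simpa only [Finset.sum_empty] using hP.isLeadingPart_zero k
  | cons i s hi ih =>
    simpa only [Finset.sum_cons] using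
      hP.isLeadingPart_add (hP.isLeadingPart_smul hk (b i).2 (hcoord i)) ih

theorem mem_of_tendsto_of_mem_fil (hP : IsHorizontalSubgroup S F P) {d k : ℕ} (hk : 1 ≤ k)
    (hd : S.step < k + d) {u : ι → V} {u₀ : V} (hu : Tendsto u F (𝓝 u₀))
    (huk : ∀ n, u n ∈ S.fil k) : u ∈ P := by
  induction d generalizing k u u₀ with
  | zero =>
    rw [show u = fun _ => 0 from funext fun n => S.eq_zero_of_mem_fil hd (huk n)]
    exact hP.zero_mem
  | succ d ih =>
    obtain ⟨g, hgP, ⟨g₀, hg₀⟩, hg⟩ := hP.isLeadingPart_proj hk hu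
    have hquot (n : ι) : S.mul (u n) (-g n) ∈ S.fil (k + 1) := by
      have hsub : u n + -g n ∈ S.fil (k + 1) :=
        sub_eq_add_neg (u n) (g n) ▸ S.sub_mem_fil_succ (huk n) (hg n).1 (hg n).2.symm
      exact (Submodule.sub_mem_iff_left _ hsub).1 (S.mul_sub_add_mem_fil
        (S.lie_mem_fil_right _ (Submodule.neg_mem _ (hg n).1)))
    have hquotP := ih (Nat.le_succ_of_le hk) (by omega) (tendsto_mul hu hg₀.neg) hquot
    simpa only [S.mul_assoc, S.neg_mul_self, S.mul_zero] using hP.mul_mem _ hquotP _ hgP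

/-- Convergent families are built from the horizontal ones layer by layer: dividing by a family
with the same component of lowest degree increases the degree. -/
theorem mem_of_tendsto (hP : IsHorizontalSubgroup S F P) {u : ι → V} {u₀ : V}
    (hu : Tendsto u F (𝓝 u₀)) : u ∈ P :=
  hP.mem_of_tendsto_of_mem_fil le_rfl (d := S.step) (by omega) hu fun n => S.mem_fil_one (u n)

end IsHorizontalSubgroup

end HorizontalGeneration

end Stratification

namespace HomogeneousDistance

section Algebra

variable {V : Type*} [LieRing V] [LieAlgebra ℝ V] {S : Stratification V}
  (ρ : HomogeneousDistance S)

theorem dist_self (x : V) : ρ.dist x x = 0 := (ρ.dist_eq_zero x x).2 rfl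

theorem dist_nonneg (x y : V) : 0 ≤ ρ.dist x y := by
  have htriangle := ρ.dist_triangle x y x
  rw [ρ.dist_self, ρ.dist_comm y x] at htriangle
  linarith

theorem dist_pos {x y : V} (h : x ≠ y) : 0 < ρ.dist x y :=
  (ρ.dist_nonneg x y).lt_of_ne fun h' => h ((ρ.dist_eq_zero x y).1 h'.symm)

theorem abs_dist_sub_dist_le (x y x' y' : V) :
    |ρ.dist x y - ρ.dist x' y'| ≤ ρ.dist x x' + ρ.dist y y' := by
  have h₁ := ρ.dist_triangle x x' y
  have h₂ := ρ.dist_triangle x' y' y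
  have h₃ := ρ.dist_triangle x' x y'
  have h₄ := ρ.dist_triangle x y y'
  rw [ρ.dist_comm y' y] at h₂
  rw [ρ.dist_comm x' x] at h₃
  exact abs_le.2 ⟨by linarith, by linarith⟩

theorem dist_eq_dist_zero (x y : V) : ρ.dist x y = ρ.dist 0 (S.mul (-x) y) := by
  rw [← ρ.dist_mul_left (-x) x y, S.neg_mul_self]

theorem dist_mul_right_eq (x u : V) : ρ.dist x (S.mul x u) = ρ.dist 0 u := by
  rw [dist_eq_dist_zero, S.neg_mul_cancel_left]

theorem dist_zero_neg (x : V) : ρ.dist 0 (-x) = ρ.dist 0 x := by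
  rw [ρ.dist_comm 0 x, ρ.dist_eq_dist_zero x 0, S.mul_zero]

theorem dist_zero_mul_le (x y : V) : ρ.dist 0 (S.mul x y) ≤ ρ.dist 0 x + ρ.dist 0 y := by
  simpa only [dist_mul_right_eq] using ρ.dist_triangle 0 x (S.mul x y)

theorem dist_zero_dilation {t : ℝ} (ht : 0 < t) (x : V) :
    ρ.dist 0 (S.dilation t x) = t * ρ.dist 0 x := by
  rw [← ρ.dist_dilation t ht, S.dilation_zero]

theorem dist_zero_smul {a : V} (ha : a ∈ S.layer 1) (c : ℝ) :
    ρ.dist 0 (c • a) = |c| * ρ.dist 0 a := by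
  have hpos {t : ℝ} (ht : 0 < t) : ρ.dist 0 (t • a) = t * ρ.dist 0 a := by
    rw [← ρ.dist_zero_dilation ht, S.dilation_of_mem ha, pow_one]
  rcases lt_trichotomy c 0 with hc | rfl | hc
  · rw [abs_of_neg hc, ← dist_zero_neg, ← neg_smul, hpos (neg_pos.2 hc)]
  · rw [zero_smul, dist_self, abs_zero, MulZeroClass.zero_mul]
  · rw [abs_of_pos hc, hpos hc]

end Algebra

variable {V : Type*} [LieRing V] [LieAlgebra ℝ V] [FiniteDimensional ℝ V] [TopologicalSpace V]
  [IsTopologicalAddGroup V] [ContinuousSMul ℝ V] [T2Space V] {S : Stratification V}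
  (ρ : HomogeneousDistance S) {ι : Type*} {F : Filter ι}

theorem isBoundedUnder_dist_zero {u : ι → V} {u₀ : V} (hu : Tendsto u F (𝓝 u₀)) :
    IsBoundedUnder (· ≤ ·) F fun n => ρ.dist 0 (u n) := by
  have hsubgroup : Stratification.IsHorizontalSubgroup S F
      {u | IsBoundedUnder (· ≤ ·) F fun n => ρ.dist 0 (u n)} := by
    refine ⟨fun u hu w hw => ?_, fun u hu => ?_, fun a ha c c₀ hc => ?_⟩
    · exact (isBoundedUnder_le_add hu hw).mono_le
        (Eventually.of_forall fun n => ρ.dist_zero_mul_le (u n) (w n))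
    · simpa only [Set.mem_ofPred_eq, dist_zero_neg] using hu
    · simpa only [Set.mem_ofPred_eq, ρ.dist_zero_smul ha] using
        (hc.abs.mul_const (ρ.dist 0 a)).isBoundedUnder_le
  exact hsubgroup.mem_of_tendsto hu

theorem tendsto_dist_zero {u : ι → V} (hu : Tendsto u F (𝓝 0)) :
    Tendsto (fun n => ρ.dist 0 (u n)) F (𝓝 0) := by
  obtain ⟨C, hC⟩ := ρ.isBoundedUnder_dist_zero (F := 𝓝 (0 : V)) tendsto_id
  refine tendsto_order.2 ⟨fun a ha => Eventually.of_forall fun n =>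
    ha.trans_le (ρ.dist_nonneg _ _), fun ε hε => ?_⟩
  obtain ⟨r, hr, hrC⟩ := exists_pos_mul_lt hε C
  have hdil := Stratification.tendsto_dilation (S := S) (tendsto_const_nhds (x := r⁻¹)) hu
  rw [S.dilation_zero] at hdil
  filter_upwards [hdil.eventually (eventually_map.1 hC)] with n hn
  rw [id, ρ.dist_zero_dilation (inv_pos.2 hr), inv_mul_le_iff₀ hr, mul_comm] at hn
  exact hn.trans_lt hrC

theorem tendsto_dist {u v : ι → V} {u₀ v₀ : V} (hu : Tendsto u F (𝓝 u₀))
    (hv : Tendsto v F (𝓝 v₀)) :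
    Tendsto (fun n => ρ.dist (u n) (v n)) F (𝓝 (ρ.dist u₀ v₀)) := by
  have hself {u : ι → V} {u₀ : V} (hu : Tendsto u F (𝓝 u₀)) :
      Tendsto (fun n => ρ.dist (u n) u₀) F (𝓝 0) := by
    have hquot := Stratification.tendsto_mul (S := S) hu.neg (tendsto_const_nhds (x := u₀))
    rw [S.neg_mul_self] at hquot
    simpa only [← dist_eq_dist_zero] using ρ.tendsto_dist_zero hquot
  have hsum := (hself hu).add (hself hv)
  rw [add_zero] at hsum
  exact tendsto_iff_dist_tendsto_zero.2 (squeeze_zero (fun _ => _root_.dist_nonneg)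
    (fun n => ρ.abs_dist_sub_dist_le _ _ _ _) hsum)

theorem continuous_dist_zero : Continuous (ρ.dist 0) :=
  continuous_iff_continuousAt.2 fun _ => ρ.tendsto_dist tendsto_const_nhds tendsto_id

/-- The infimum of `ρ(0, ·)` over a sphere of the norm is positive, and every point outside the
sphere is dilated into it by a factor at most `1`. -/
theorem exists_forall_dist_zero_lt_imp_norm_lt {E : Type*} [NormedAddCommGroup E]
    [NormedSpace ℝ E] [ProperSpace E] (e : V ≃L[ℝ] E) {ε : ℝ} (hε : 0 < ε) :
    ∃ c > 0, ∀ x, ρ.dist 0 x < c → ‖e x‖ < ε := by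
  have hsphere : IsCompact (e.symm '' Metric.sphere 0 ε) :=
    (isCompact_sphere 0 ε).image e.symm.continuous
  obtain ⟨c, hc, hcsphere⟩ := hsphere.exists_forall_le' (a := 0)
    ρ.continuous_dist_zero.continuousOn (by
      rintro _ ⟨y, hy, rfl⟩
      refine ρ.dist_pos fun h => Metric.ne_of_mem_sphere hy hε.ne' ?_
      exact (map_eq_zero_iff e.symm e.symm.injective).1 h.symm)
  refine ⟨c, hc, fun x hx => ?_⟩
  by_contra! hle
  have hcont : ContinuousOn (fun t => ‖e (S.dilation t x)‖) (Set.Icc 0 1) :=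
    (e.continuous.comp (S.continuous_dilation.comp
      (continuous_id.prodMk continuous_const))).norm.continuousOn
  have hmem : ε ∈ Set.Icc ‖e (S.dilation 0 x)‖ ‖e (S.dilation 1 x)‖ := by
    rw [S.zero_dilation, S.dilation_one, map_zero, norm_zero]
    exact ⟨hε.le, hle⟩
  obtain ⟨t, ht, hte⟩ := intermediate_value_Icc zero_le_one hcont hmem
  have ht₀ : 0 < t := ht.1.lt_of_ne fun h => by
    simp only [← h, S.zero_dilation, map_zero, norm_zero] at hte
    exact hε.ne hte
  have hdist := hcsphere (S.dilation t x)
    ⟨e (S.dilation t x), mem_sphere_zero_iff_norm.2 hte, e.symm_apply_apply _⟩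
  rw [ρ.dist_zero_dilation ht₀] at hdist
  exact hx.not_ge (hdist.trans (mul_le_of_le_one_left (ρ.dist_nonneg _ _) ht.2))

theorem tendsto_zero_of_dist {u : ι → V} (hu : Tendsto (fun n => ρ.dist 0 (u n)) F (𝓝 0)) :
    Tendsto u F (𝓝 0) := by
  let e := (Module.finBasis ℝ V).equivFun.toContinuousLinearEquiv
  have hcoord : Tendsto (fun n => e (u n)) F (𝓝 0) := by
    rw [tendsto_zero_iff_norm_tendsto_zero, Metric.tendsto_nhds]
    intro ε hε
    obtain ⟨c, hc, hce⟩ := ρ.exists_forall_dist_zero_lt_imp_norm_lt e hε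
    filter_upwards [hu.eventually_lt_const hc] with n hn
    simpa using hce _ hn
  simpa [Function.comp_def] using (e.symm.continuous.tendsto 0).comp hcoord

theorem tendsto_of_dist {u v : ι → V} {u₀ : V} (hu : Tendsto u F (𝓝 u₀))
    (hv : Tendsto (fun n => ρ.dist (u n) (v n)) F (𝓝 0)) : Tendsto v F (𝓝 u₀) := by
  simp only [ρ.dist_eq_dist_zero (u _)] at hv
  simpa only [S.mul_neg_cancel_left, S.mul_zero] using
    Stratification.tendsto_mul (S := S) hu (ρ.tendsto_zero_of_dist hv)

theorem exists_dist_lt_imp_mem {p : V} {s : Set V} (hs : s ∈ 𝓝 p) :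
    ∃ ε > 0, ∀ x, ρ.dist p x < ε → x ∈ s := by
  have htendsto := ρ.tendsto_of_dist (F := comap (ρ.dist p) (𝓝 0)) (v := id)
    (tendsto_const_nhds (x := p)) tendsto_comap
  obtain ⟨t, ht, hts⟩ := mem_comap.1 (htendsto hs)
  obtain ⟨ε, hε, hεt⟩ := Metric.mem_nhds_iff.1 ht
  refine ⟨ε, hε, fun x hx => hts (hεt ?_)⟩
  rwa [Metric.mem_ball, Real.dist_eq, sub_zero, abs_of_nonneg (ρ.dist_nonneg _ _)]

theorem isCompact_setOf_dist_zero_le (r : ℝ) : IsCompact {x | ρ.dist 0 x ≤ r} := by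
  let e := (Module.finBasis ℝ V).equivFun.toContinuousLinearEquiv
  obtain ⟨c, hc, hce⟩ := ρ.exists_forall_dist_zero_lt_imp_norm_lt e one_pos
  obtain ⟨t, ht, htc⟩ := exists_pos_mul_lt hc r
  have hball : IsCompact (S.dilation t⁻¹ '' (e.symm '' Metric.closedBall 0 1)) :=
    ((isCompact_closedBall 0 1).image e.symm.continuous).image
      (S.continuous_dilation.comp (continuous_const.prodMk continuous_id))
  refine hball.of_isClosed_subset (isClosed_le ρ.continuous_dist_zero continuous_const)
    fun x hx => ?_
  have hdist : ρ.dist 0 (S.dilation t x) < c := by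
    rw [ρ.dist_zero_dilation ht, mul_comm]
    exact (mul_le_mul_of_nonneg_right hx ht.le).trans_lt htc
  exact ⟨S.dilation t x, ⟨e (S.dilation t x), mem_closedBall_zero_iff.2 (hce _ hdist).le,
    e.symm_apply_apply _⟩, S.dilation_inv_dilation ht.ne' x⟩

theorem exists_tendsto_of_dist_le (F : Ultrafilter ι) {u : ι → V} {r : ℝ}
    (hu : ∀ᶠ n in F, ρ.dist 0 (u n) ≤ r) : ∃ u₀, Tendsto u F (𝓝 u₀) := by
  obtain ⟨u₀, -, hu₀⟩ := (ρ.isCompact_setOf_dist_zero_le r).ultrafilter_le_nhds (F.map u)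
    (le_principal_iff.2 hu)
  exact ⟨u₀, hu₀⟩

end HomogeneousDistance

theorem tendsto_zero_of_hasDerivWithinAt {E : Type*} [NormedAddCommGroup E] [NormedSpace ℝ E]
    {ι : Type*} {F : Filter ι} {φ φ' : ι → ℝ → E} (hφ_zero : ∀ n, φ n 0 = 0)
    (hφ : ∀ᶠ n in F, ∀ t ∈ Set.Icc (0 : ℝ) 1,
      HasDerivWithinAt (φ n) (φ' n t) (Set.Icc 0 1) t)
    (hφ' : Tendsto (fun x : ι × ℝ => φ' x.1 x.2) (F ×ˢ 𝓟 (Set.Icc 0 1)) (𝓝 0)) :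
    Tendsto (fun x : ι × ℝ => φ x.1 x.2) (F ×ˢ 𝓟 (Set.Icc 0 1)) (𝓝 0) := by
  rw [Metric.tendsto_nhds] at hφ' ⊢
  intro ε hε
  have hsmall := hφ' (ε / 2) (half_pos hε)
  rw [eventually_prod_principal_iff] at hsmall ⊢
  filter_upwards [hsmall, hφ] with n hn hderiv t ht
  simp only [dist_zero_right] at hn ⊢
  have hbound := (convex_Icc (0 : ℝ) 1).norm_image_sub_le_of_norm_hasDerivWithin_le hderiv
    (fun t ht => (hn t ht).le) (Set.left_mem_Icc.2 zero_le_one) ht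
  rw [hφ_zero, sub_zero, sub_zero, Real.norm_of_nonneg ht.1] at hbound
  exact (hbound.trans (mul_le_of_le_one_right (half_pos hε).le ht.2)).trans_lt (half_lt_self hε)

/-- A `C¹` product on a normed space in triangular form: the `j`-th component of `g * u - g`
depends on `g` only through the components of index less than `j`. The curves `t ↦ t • x` are
moreover one-parameter groups. This is what a stratified group looks like in linear coordinates,
and it lets one use derivatives, the topology of the group not being given by a norm. -/
structure TriangularProduct (E : Type*) [NormedAddCommGroup E] [NormedSpace ℝ E] where
  mul : E → E → E
  contDiff_mul : ContDiff ℝ 1 fun x : E × E => mul x.1 x.2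
  numComponents : ℕ
  proj : ℕ → E →L[ℝ] E
  sum_proj : ∀ x, ∑ j ∈ Finset.range numComponents, proj j x = x
  proj_proj : ∀ i j x, proj i (proj j x) = if i = j then proj i x else 0
  proj_mul_sub : ∀ j g g' u, (∀ i < j, proj i g = proj i g') →
    proj j (mul g u) - proj j g = proj j (mul g' u) - proj j g'
  smul_mul_smul : ∀ (a b : ℝ) x, mul (a • x) (b • x) = (a + b) • x

namespace TriangularProduct

variable {E : Type*} [NormedAddCommGroup E] [NormedSpace ℝ E] (P : TriangularProduct E)

/-- The differential at the origin of the left translation by `g`. -/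
noncomputable def leftDeriv (g : E) : E →L[ℝ] E :=
  (fderiv ℝ (fun x : E × E => P.mul x.1 x.2) (g, 0)).comp (ContinuousLinearMap.inr ℝ E E)

theorem continuous_leftDeriv : Continuous P.leftDeriv :=
  ((P.contDiff_mul.continuous_fderiv one_ne_zero).comp
    (continuous_id.prodMk continuous_const)).clm_comp continuous_const

theorem hasFDerivAt_mul (g : E) : HasFDerivAt (P.mul g) (P.leftDeriv g) 0 :=
  (P.contDiff_mul.differentiable one_ne_zero (g, 0)).hasFDerivAt.comp (0 : E)
    (hasFDerivAt_prodMk_right g 0)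

theorem proj_leftDeriv_eq {j : ℕ} {g g' : E} (h : ∀ i < j, P.proj i g = P.proj i g') (x : E) :
    P.proj j (P.leftDeriv g x) = P.proj j (P.leftDeriv g' x) := by
  have hderiv (k : E) : HasFDerivAt (fun u => P.proj j (P.mul k u) - P.proj j k)
      ((P.proj j).comp (P.leftDeriv k)) 0 :=
    ((P.proj j).hasFDerivAt.comp (0 : E) (P.hasFDerivAt_mul k)).sub_const _
  have hderiv_g := hderiv g
  simp only [fun u => P.proj_mul_sub j g g' u h] at hderiv_g
  exact DFunLike.congr_fun (hderiv_g.unique (hderiv g')) x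

theorem leftDeriv_smul_self (t : ℝ) (x : E) : P.leftDeriv (t • x) x = x := by
  have hline : HasDerivAt (fun b : ℝ => b • x) x 0 := by
    simpa only [one_smul] using (hasDerivAt_id' (0 : ℝ)).smul_const x
  have hmul : HasDerivAt (fun b : ℝ => P.mul (t • x) (b • x)) (P.leftDeriv (t • x) x) 0 :=
    (P.hasFDerivAt_mul (t • x)).comp_hasDerivAt_of_eq 0 hline (zero_smul ℝ x).symm
  have hadd : HasDerivAt (fun b : ℝ => (t + b) • x) x 0 := by
    simpa only [one_smul] using ((hasDerivAt_id' (0 : ℝ)).const_add t).smul_const x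
  simp only [P.smul_mul_smul] at hmul
  exact hmul.unique hadd

theorem hasDerivAt_of_add_eq_mul {γ u : ℝ → E} {x : E} {t : ℝ} (hu_zero : u 0 = 0)
    (hu : HasDerivAt u x 0) (hγ : ∀ h, γ (t + h) = P.mul (γ t) (u h)) :
    HasDerivAt γ (P.leftDeriv (γ t) x) t := by
  have hmul : HasDerivAt (fun h => P.mul (γ t) (u h)) (P.leftDeriv (γ t) x) 0 :=
    (P.hasFDerivAt_mul _).comp_hasDerivAt_of_eq 0 hu hu_zero.symm
  simp only [← hγ] at hmul
  rw [← sub_self t] at hmul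
  simpa only [add_sub_cancel] using hmul.comp_sub_const t t

theorem tendsto_proj_leftDeriv {α : Type*} {G : Filter α} {g X : α → E} {T : α → ℝ} {X₀ : E}
    {j : ℕ} (hT : ∀ᶠ a in G, T a ∈ Set.Icc (0 : ℝ) 1)
    (hg : ∀ i < j, Tendsto (fun a => P.proj i (g a - T a • X₀)) G (𝓝 0))
    (hX : Tendsto X G (𝓝 X₀)) :
    Tendsto (fun a => P.proj j (P.leftDeriv (g a) (X a)) - P.proj j X₀) G (𝓝 0) := by
  let gLow : α → E := fun a => T a • X₀ + ∑ i ∈ Finset.range j, P.proj i (g a - T a • X₀)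
  have hlow (a : α) : P.proj j (P.leftDeriv (g a) (X a)) =
      P.proj j (P.leftDeriv (gLow a) (X a)) := by
    refine P.proj_leftDeriv_eq (fun i hi => ?_) _
    simp only [gLow, map_add, map_sum, P.proj_proj]
    rw [Finset.sum_ite_eq, if_pos (Finset.mem_range.2 hi), map_sub, add_sub_cancel]
  simp only [hlow]
  refine (tendsto_iff_ultrafilter _ _ _).2 fun U hU => ?_
  obtain ⟨t, -, ht⟩ := (isCompact_Icc (a := (0 : ℝ)) (b := 1)).ultrafilter_le_nhds
    (U.map T) (le_principal_iff.2 (hU hT))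
  have hgLow : Tendsto gLow U (𝓝 (t • X₀)) := by
    have hsum := tendsto_finsetSum (Finset.range j) fun i hi =>
      (hg i (Finset.mem_range.1 hi)).mono_left hU
    simpa only [Finset.sum_const_zero, add_zero] using
      (Tendsto.smul_const (f := T) ht X₀).add hsum
  have hderiv : Tendsto (fun a => P.leftDeriv (gLow a) (X a)) U
      (𝓝 (P.leftDeriv (t • X₀) X₀)) :=
    (isBoundedBilinearMap_apply.continuous.tendsto (P.leftDeriv (t • X₀), X₀)).comp
      (((P.continuous_leftDeriv.tendsto _).comp hgLow).prodMk_nhds (hX.mono_left hU))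
  rw [P.leftDeriv_smul_self] at hderiv
  simpa only [sub_self, Function.comp_def] using
    (((P.proj j).continuous.tendsto _).comp hderiv).sub_const (P.proj j X₀)

section Curves

variable {ι : Type*} {F : Filter ι} {Γ X : ι → ℝ → E} {X₀ : E}

/-- By induction on `j`: the `j`-th component of `Γ' = leftDeriv Γ X` only involves the components
of `Γ` of index less than `j`. -/
theorem tendsto_proj_sub_smul (hΓ_zero : ∀ n, Γ n 0 = 0)
    (hΓ : ∀ᶠ n in F, ∀ t ∈ Set.Icc (0 : ℝ) 1,
      HasDerivAt (Γ n) (P.leftDeriv (Γ n t) (X n t)) t)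
    (hX : Tendsto (fun x : ι × ℝ => X x.1 x.2) (F ×ˢ 𝓟 (Set.Icc 0 1)) (𝓝 X₀)) (j : ℕ) :
    Tendsto (fun x : ι × ℝ => P.proj j (Γ x.1 x.2 - x.2 • X₀)) (F ×ˢ 𝓟 (Set.Icc 0 1)) (𝓝 0) := by
  induction j using Nat.strong_induction_on with
  | _ j ih =>
  have hmem : ∀ᶠ x : ι × ℝ in F ×ˢ 𝓟 (Set.Icc 0 1), x.2 ∈ Set.Icc (0 : ℝ) 1 :=
    tendsto_snd.eventually (mem_principal_self _)
  refine tendsto_zero_of_hasDerivWithinAt (φ := fun n t => P.proj j (Γ n t - t • X₀))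
    (φ' := fun n t => P.proj j (P.leftDeriv (Γ n t) (X n t)) - P.proj j X₀)
    (fun n => by rw [hΓ_zero, zero_smul, sub_zero, map_zero]) ?_
    (P.tendsto_proj_leftDeriv hmem ih hX)
  filter_upwards [hΓ] with n hn t ht
  have hsub := (hn t ht).fun_sub ((hasDerivAt_id' t).smul_const X₀)
  simpa only [Function.comp_def, one_smul, map_sub] using
    ((P.proj j).hasFDerivAt.comp_hasDerivAt t hsub).hasDerivWithinAt

theorem tendsto_endpoint (hΓ_zero : ∀ n, Γ n 0 = 0)
    (hΓ : ∀ᶠ n in F, ∀ t ∈ Set.Icc (0 : ℝ) 1,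
      HasDerivAt (Γ n) (P.leftDeriv (Γ n t) (X n t)) t)
    (hX : Tendsto (fun x : ι × ℝ => X x.1 x.2) (F ×ˢ 𝓟 (Set.Icc 0 1)) (𝓝 X₀)) :
    Tendsto (fun n => Γ n 1) F (𝓝 X₀) := by
  have hone : Tendsto (fun n => ((n, 1) : ι × ℝ)) F (F ×ˢ 𝓟 (Set.Icc 0 1)) :=
    tendsto_id.prodMk (tendsto_principal.2
      (Eventually.of_forall fun _ => Set.right_mem_Icc.2 zero_le_one))
  have hsum := tendsto_finsetSum (Finset.range P.numComponents) fun j _ =>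
    (P.tendsto_proj_sub_smul hΓ_zero hΓ hX j).comp hone
  simp only [Function.comp_def, P.sum_proj, one_smul, Finset.sum_const_zero] at hsum
  exact tendsto_sub_nhds_zero_iff.1 hsum

end Curves

end TriangularProduct

namespace Stratification

variable {V : Type*} [LieRing V] [LieAlgebra ℝ V] [FiniteDimensional ℝ V] [TopologicalSpace V]
  [IsTopologicalAddGroup V] [ContinuousSMul ℝ V] [T2Space V] (S : Stratification V)

/-- The group law of `S` in the linear coordinates `e`. -/
noncomputable def triangularProduct {E : Type*} [NormedAddCommGroup E] [NormedSpace ℝ E]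
    [FiniteDimensional ℝ E] (e : V ≃L[ℝ] E) : TriangularProduct E where
  mul x y := e (S.mul (e.symm x) (e.symm y))
  contDiff_mul := contDiff_mul_coordinates e.toLinearEquiv S
  numComponents := S.step + 1
  proj j := LinearMap.toContinuousLinearMap
    (e.toLinearEquiv.toLinearMap ∘ₗ S.proj j ∘ₗ e.symm.toLinearEquiv.toLinearMap)
  sum_proj x := by
    change ∑ j ∈ Finset.range (S.step + 1), e (S.proj j (e.symm x)) = x
    rw [← map_sum, S.sum_proj, e.apply_symm_apply]
  proj_proj i j x := by
    change e (S.proj i (e.symm (e (S.proj j (e.symm x))))) =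
      if i = j then e (S.proj i (e.symm x)) else 0
    rw [e.symm_apply_apply, S.proj_proj, apply_ite e, map_zero]
  proj_mul_sub j g g' u h := by
    change e (S.proj j (e.symm (e _))) - e (S.proj j (e.symm g)) =
      e (S.proj j (e.symm (e _))) - e (S.proj j (e.symm g'))
    rw [e.symm_apply_apply, e.symm_apply_apply, ← map_sub e, ← map_sub e]
    exact congrArg e (S.proj_mul_sub (fun i hi => e.injective (h i hi)) _)
  smul_mul_smul a b x := by
    rw [map_smul, map_smul, S.smul_mul_smul, map_smul, e.apply_symm_apply]

/-- The hypothesis on `Γ` says that `Γ n (t + h) = Γ n t * (h • X n t + o(h))`. -/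
theorem tendsto_endpoint {ι : Type*} {F : Filter ι} {Γ X : ι → ℝ → V} {X₀ : V}
    (hΓ_zero : ∀ n, Γ n 0 = 0)
    (hΓ : ∀ᶠ n in F, ∀ t ∈ Set.Icc (0 : ℝ) 1,
      Tendsto (fun h : ℝ => h⁻¹ • S.mul (-Γ n t) (Γ n (t + h))) (𝓝[≠] 0) (𝓝 (X n t)))
    (hX : Tendsto (fun x : ι × ℝ => X x.1 x.2) (F ×ˢ 𝓟 (Set.Icc 0 1)) (𝓝 X₀)) :
    Tendsto (fun n => Γ n 1) F (𝓝 X₀) := by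
  let e := (Module.finBasis ℝ V).equivFun.toContinuousLinearEquiv
  have hderiv : ∀ᶠ n in F, ∀ t ∈ Set.Icc (0 : ℝ) 1, HasDerivAt (fun s => e (Γ n s))
      ((S.triangularProduct e).leftDeriv (e (Γ n t)) (e (X n t))) t := by
    filter_upwards [hΓ] with n hn t ht
    refine (S.triangularProduct e).hasDerivAt_of_add_eq_mul (γ := fun s => e (Γ n s))
      (u := fun h => e (S.mul (-Γ n t) (Γ n (t + h)))) ?_ ?_ fun h => ?_
    · rw [add_zero, S.neg_mul_self, map_zero]
    · rw [hasDerivAt_iff_tendsto_slope_zero]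
      simpa only [Function.comp_def, zero_add, add_zero, S.neg_mul_self, map_zero, sub_zero,
        map_smul] using (e.continuous.tendsto _).comp (hn t ht)
    · change _ = e (S.mul (e.symm (e _)) (e.symm (e _)))
      rw [e.symm_apply_apply, e.symm_apply_apply, S.mul_neg_cancel_left]
  have hend := (S.triangularProduct e).tendsto_endpoint (Γ := fun n s => e (Γ n s))
    (fun n => by rw [hΓ_zero, map_zero]) hderiv ((e.continuous.tendsto X₀).comp hX)
  simpa only [Function.comp_def, e.symm_apply_apply] using (e.symm.continuous.tendsto _).comp hend

end Stratification

section PansuQuotient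

variable {V V' : Type*} [LieRing V] [LieAlgebra ℝ V] [LieRing V'] [LieAlgebra ℝ V']
  (S : Stratification V) (S' : Stratification V')

/-- The difference quotient `δ_{1/t} (f(q)⁻¹ f(q δ_t v))`, whose limit as `t → 0` is the Pansu
differential of `f` at `q` applied to `v`. Negative values of `t` are allowed. -/
noncomputable def pansuQuotient (f : V → V') (q : V) (t : ℝ) (v : V) : V' :=
  S'.dilation t⁻¹ (S'.mul (-f q) (f (S.mul q (S.dilation t v))))

variable (f : V → V') (q : V) (t : ℝ)

theorem pansuQuotient_zero : pansuQuotient S S' f q t 0 = 0 := by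
  rw [pansuQuotient, S.dilation_zero, S.mul_zero, S'.neg_mul_self, S'.dilation_zero]

theorem pansuQuotient_mul (u v : V) :
    pansuQuotient S S' f q t (S.mul u v) = S'.mul (pansuQuotient S S' f q t u)
      (pansuQuotient S S' f (S.mul q (S.dilation t u)) t v) := by
  simp only [pansuQuotient]
  rw [← S'.dilation_mul, S'.neg_mul_mul_neg_mul, S.dilation_mul, S.mul_assoc]

theorem pansuQuotient_neg (v : V) : pansuQuotient S S' f q t (-v) =
    -pansuQuotient S S' f (S.mul q (S.dilation t (-v))) t v := by
  simp only [pansuQuotient]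
  rw [S.mul_assoc, ← S.dilation_mul, S.neg_mul_self, S.dilation_zero, S.mul_zero,
    ← S'.dilation_neg, S'.neg_mul_rev, neg_neg]

theorem pansuQuotient_dilation {s : ℝ} (hs : s ≠ 0) (v : V) :
    pansuQuotient S S' f q t (S.dilation s v) =
      S'.dilation s (pansuQuotient S S' f q (t * s) v) := by
  simp only [pansuQuotient]
  rw [S.dilation_dilation, S'.dilation_dilation, mul_inv_rev, mul_inv_cancel_left₀ hs]

variable {S S'} {t} in
theorem dist_pansuQuotient (ρ' : HomogeneousDistance S') (L : HomogeneousHom S S') (ht : 0 < t)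
    (v : V) : ρ'.dist (pansuQuotient S S' f q t v) (L.toLieHom v) =
      ρ'.dist (S'.mul (-f q) (f (S.mul q (S.dilation t v)))) (L.toLieHom (S.dilation t v)) / t := by
  rw [eq_div_iff ht.ne', mul_comm, ← ρ'.dist_dilation t ht, pansuQuotient,
    S'.dilation_dilation_inv ht.ne', L.map_dilation]

end PansuQuotient

section HomDist

variable {V V' : Type*} [LieRing V] [LieAlgebra ℝ V] [LieRing V'] [LieAlgebra ℝ V']
  {S : Stratification V} {S' : Stratification V'}
  {ρ : HomogeneousDistance S} {ρ' : HomogeneousDistance S'}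

theorem homDist_le_ofReal {L M : HomogeneousHom S S'} {η : ℝ}
    (h : ∀ v, ρ'.dist (L.toLieHom v) (M.toLieHom v) ≤ η * ρ.dist 0 v) :
    homDist ρ ρ' L M ≤ ENNReal.ofReal η :=
  iSup₂_le fun v hv =>
    ENNReal.ofReal_le_ofReal ((div_le_iff₀ (ρ.dist_pos hv.symm)).2 (h v))

theorem ofReal_dist_le_homDist_mul (L M : HomogeneousHom S S') (v : V) :
    ENNReal.ofReal (ρ'.dist (L.toLieHom v) (M.toLieHom v)) ≤
      homDist ρ ρ' L M * ENNReal.ofReal (ρ.dist 0 v) := by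
  rcases eq_or_ne v 0 with rfl | hv
  · simp only [map_zero, ρ'.dist_self, ENNReal.ofReal_zero, zero_le]
  have hpos := ρ.dist_pos hv.symm
  rw [← div_mul_cancel₀ (ρ'.dist _ _) hpos.ne', ENNReal.ofReal_mul' hpos.le]
  gcongr
  exact le_iSup₂ (f := fun (v : V) (_ : v ≠ 0) => ENNReal.ofReal
    (ρ'.dist (L.toLieHom v) (M.toLieHom v) / ρ.dist 0 v)) v hv

theorem tendsto_apply_of_homDist [FiniteDimensional ℝ V'] [TopologicalSpace V']
    [IsTopologicalAddGroup V'] [ContinuousSMul ℝ V'] [T2Space V'] {ι : Type*} {F : Filter ι}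
    {D : ι → HomogeneousHom S S'} {L : HomogeneousHom S S'}
    (h : Tendsto (fun n => homDist ρ ρ' (D n) L) F (𝓝 0)) (v : V) :
    Tendsto (fun n => (D n).toLieHom v) F (𝓝 (L.toLieHom v)) := by
  refine ρ'.tendsto_of_dist (u := fun _ => L.toLieHom v) tendsto_const_nhds ?_
  have hmul := ENNReal.Tendsto.mul_const (b := ENNReal.ofReal (ρ.dist 0 v)) h
    (Or.inr ENNReal.ofReal_ne_top)
  rw [MulZeroClass.zero_mul] at hmul
  have hdist := tendsto_of_tendsto_of_tendsto_of_le_of_le tendsto_const_nhds hmul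
    (fun _ => zero_le) fun n => ofReal_dist_le_homDist_mul (ρ := ρ) (ρ' := ρ') (D n) L v
  simpa only [Function.comp_def, ENNReal.toReal_zero, ENNReal.toReal_ofReal (ρ'.dist_nonneg _ _),
    ρ'.dist_comm] using (ENNReal.tendsto_toReal ENNReal.zero_ne_top).comp hdist

end HomDist

section Domain

variable {V : Type*} [LieRing V] [LieAlgebra ℝ V] [FiniteDimensional ℝ V] [TopologicalSpace V]
  [IsTopologicalAddGroup V] [ContinuousSMul ℝ V] [T2Space V] {S : Stratification V}

theorem Stratification.tendsto_mul_dilation {ι : Type*} {F : Filter ι} {y u : ι → V} {r : ι → ℝ}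
    {p u₀ : V} (hy : Tendsto y F (𝓝 p)) (hr : Tendsto r F (𝓝 0)) (hu : Tendsto u F (𝓝 u₀)) :
    Tendsto (fun n => S.mul (y n) (S.dilation (r n) (u n))) F (𝓝 p) := by
  simpa only [S.zero_dilation, S.mul_zero] using
    Stratification.tendsto_mul (S := S) hy (Stratification.tendsto_dilation (S := S) hr hu)

theorem Stratification.tendsto_mul_dilation_nhdsGT (S : Stratification V) (q v : V) :
    Tendsto (fun t => S.mul q (S.dilation t v)) (𝓝[>] 0) (𝓝 q) :=
  Stratification.tendsto_mul_dilation tendsto_const_nhds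
    (tendsto_id.mono_left nhdsWithin_le_nhds) tendsto_const_nhds

theorem Stratification.tendsto_inv_smul_dilation {ι : Type*} {F : Filter ι} {k : ι → ℝ}
    {z : ι → V} {z₀ : V} (hz₀ : z₀ ∈ S.layer 1) (hk : Tendsto k F (𝓝[≠] 0))
    (hz : Tendsto z F (𝓝 z₀)) :
    Tendsto (fun n => (k n)⁻¹ • S.dilation (k n) (z n)) F (𝓝 z₀) := by
  obtain ⟨hk_zero, hk_ne⟩ := tendsto_nhdsWithin_iff.1 hk
  have hsum : Tendsto
      (fun n => ∑ j ∈ Finset.range (S.step + 1), k n ^ (j - 1) • S.proj j (z n)) F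
      (𝓝 (∑ j ∈ Finset.range (S.step + 1), (0 : ℝ) ^ (j - 1) • S.proj j z₀)) :=
    tendsto_finsetSum _ fun j _ =>
      (hk_zero.pow (j - 1)).smul (((S.continuous_proj j).tendsto z₀).comp hz)
  have hlimit : ∑ j ∈ Finset.range (S.step + 1), (0 : ℝ) ^ (j - 1) • S.proj j z₀ = z₀ := by
    conv_rhs => rw [← S.sum_proj z₀]
    refine Finset.sum_congr rfl fun j _ => ?_
    rcases eq_or_ne j 1 with rfl | hj
    · rw [Nat.sub_self, pow_zero, one_smul]
    · rw [S.proj_of_mem_ne hz₀ hj.symm, smul_zero]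
  rw [hlimit] at hsum
  refine hsum.congr' ?_
  filter_upwards [hk_ne] with n hn
  refine S.ext_proj fun j => ?_
  rw [S.proj_sum_smul_proj, map_smul, S.proj_dilation, smul_smul]
  rcases j with _ | j
  · rw [S.proj_zero_apply, smul_zero, smul_zero]
  · rw [pow_succ', inv_mul_cancel_left₀ hn, Nat.add_sub_cancel]

variable {V' : Type*} [LieRing V'] [LieAlgebra ℝ V'] {S' : Stratification V'}
  {ρ : HomogeneousDistance S} {ρ' : HomogeneousDistance S'} {Ω : Set V} {f : V → V'}

theorem HasPansuDifferentialAt.tendsto_dist_pansuQuotient {L : HomogeneousHom S S'} {q : V}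
    (hf : HasPansuDifferentialAt ρ ρ' Ω f L q) (hΩ : Ω ∈ 𝓝 q) (v : V) :
    Tendsto (fun t => ρ'.dist (pansuQuotient S S' f q t v) (L.toLieHom v)) (𝓝[>] 0) (𝓝 0) := by
  rcases eq_or_ne v 0 with rfl | hv
  · simp only [pansuQuotient_zero, map_zero, ρ'.dist_self, tendsto_const_nhds]
  have hpos : 0 < ρ.dist 0 v := ρ.dist_pos hv.symm
  have hpoint : Tendsto (fun t => S.mul q (S.dilation t v)) (𝓝[>] 0) (𝓝[Ω \ {q}] q) := by
    have hq := S.tendsto_mul_dilation_nhdsGT q v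
    refine tendsto_nhdsWithin_iff.2 ⟨hq, ?_⟩
    filter_upwards [hq hΩ, self_mem_nhdsWithin] with t htΩ ht
    refine ⟨htΩ, fun heq => (mul_pos ht hpos).ne ?_⟩
    rw [← ρ.dist_zero_dilation ht, ← ρ.dist_mul_right_eq q, Set.mem_singleton_iff.1 heq,
      ρ.dist_self]
  have hlim := (Tendsto.comp hf hpoint).mul_const (ρ.dist 0 v)
  rw [MulZeroClass.zero_mul] at hlim
  refine hlim.congr' ?_
  filter_upwards [self_mem_nhdsWithin] with t ht
  rw [dist_pansuQuotient f q ρ' L ht, Function.comp_apply, S.neg_mul_cancel_left,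
    ρ.dist_mul_right_eq, ρ.dist_zero_dilation ht, div_mul_eq_mul_div,
    mul_div_mul_right _ _ hpos.ne']

end Domain

section Forward

variable {V : Type*} [LieRing V] [LieAlgebra ℝ V] [FiniteDimensional ℝ V] [TopologicalSpace V]
  [IsTopologicalAddGroup V] [ContinuousSMul ℝ V] [T2Space V] {S : Stratification V}
  {V' : Type*} [LieRing V'] [LieAlgebra ℝ V'] [FiniteDimensional ℝ V'] [TopologicalSpace V']
  [IsTopologicalAddGroup V'] [ContinuousSMul ℝ V'] [T2Space V'] {S' : Stratification V'}
  {ρ : HomogeneousDistance S} {ρ' : HomogeneousDistance S'} {Ω : Set V} {f : V → V'}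

/-- Negative `t` are reached through the automorphisms `δ_{-1}` of the two groups. -/
theorem HasPansuDifferentialAt.tendsto_pansuQuotient {L : HomogeneousHom S S'} {q : V}
    (hf : HasPansuDifferentialAt ρ ρ' Ω f L q) (hΩ : Ω ∈ 𝓝 q) (v : V) :
    Tendsto (fun t => pansuQuotient S S' f q t v) (𝓝[≠] 0) (𝓝 (L.toLieHom v)) := by
  have hpos (v : V) :
      Tendsto (fun t => pansuQuotient S S' f q t v) (𝓝[>] 0) (𝓝 (L.toLieHom v)) := by
    have hdist := hf.tendsto_dist_pansuQuotient hΩ v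
    simp only [ρ'.dist_comm _ (L.toLieHom v)] at hdist
    exact ρ'.tendsto_of_dist tendsto_const_nhds hdist
  have hneg : Tendsto (fun t => pansuQuotient S S' f q t v) (𝓝[<] 0) (𝓝 (L.toLieHom v)) := by
    have hneg_zero : Tendsto (fun t : ℝ => -t) (𝓝[<] 0) (𝓝[>] 0) := by
      simpa only [neg_zero] using tendsto_neg_nhdsLT (a := (0 : ℝ))
    have hreflect (t : ℝ) : S'.dilation (-1) (pansuQuotient S S' f q (-t) (S.dilation (-1) v)) =
        pansuQuotient S S' f q t v := by
      rw [← mul_neg_one t, ← pansuQuotient_dilation S S' f q t (neg_ne_zero.2 one_ne_zero),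
        S.dilation_dilation, neg_mul_neg, mul_one, S.dilation_one]
    simpa only [Function.comp_def, hreflect, ← L.map_dilation, S.dilation_dilation, neg_mul_neg,
      mul_one, S.dilation_one] using Stratification.tendsto_dilation (S := S')
        (tendsto_const_nhds (x := (-1 : ℝ))) ((hpos (S.dilation (-1) v)).comp hneg_zero)
  rw [← nhdsLT_sup_nhdsGT]
  exact hneg.sup (hpos v)

theorem HasPansuDifferentialAt.tendsto_inv_smul_pansuQuotient {L : HomogeneousHom S S'} {q : V}
    (hf : HasPansuDifferentialAt ρ ρ' Ω f L q) (hΩ : Ω ∈ 𝓝 q) {r : ℝ} (hr : r ≠ 0) {v : V}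
    (hv : v ∈ S.layer 1) :
    Tendsto (fun h : ℝ => h⁻¹ • pansuQuotient S S' f q r (h • v)) (𝓝[≠] 0)
      (𝓝 (L.toLieHom v)) := by
  have hscale : Tendsto (fun h : ℝ => r * h) (𝓝[≠] 0) (𝓝[≠] 0) := by
    refine tendsto_nhdsWithin_iff.2 ⟨?_, ?_⟩
    · simpa only [MulZeroClass.mul_zero, id] using
        Tendsto.const_mul r (tendsto_id'.2 (nhdsWithin_le_nhds (a := (0 : ℝ)) (s := {0}ᶜ)))
    · filter_upwards [self_mem_nhdsWithin] with h hh using mul_ne_zero hr hh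
  refine (Stratification.tendsto_inv_smul_dilation (L.map_layer 1 v hv) tendsto_id
    ((hf.tendsto_pansuQuotient hΩ v).comp hscale)).congr' ?_
  filter_upwards [self_mem_nhdsWithin] with h hh
  rw [id, Function.comp_apply, ← pansuQuotient_dilation S S' f q r hh, S.dilation_of_mem hv,
    pow_one]

section Blowup

variable (hΩ : IsOpen Ω) {D : V → HomogeneousHom S S'}
  (hD : ∀ p ∈ Ω, HasPansuDifferentialAt ρ ρ' Ω f (D p) p) {p : V} (hp : p ∈ Ω)
  (hDp : Tendsto (fun q => homDist ρ ρ' (D q) (D p)) (𝓝[Ω] p) (𝓝 0))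
  {ι : Type*} {F : Filter ι} {r : ι → ℝ} (hr : Tendsto r F (𝓝[>] 0))

include hΩ hD hp hDp hr

theorem tendsto_pansuQuotient_smul {y : ι → V} (hy : Tendsto y F (𝓝 p)) {a : V}
    (ha : a ∈ S.layer 1) {c : ι → ℝ} {c₀ : ℝ} (hc : Tendsto c F (𝓝 c₀)) :
    Tendsto (fun n => pansuQuotient S S' f (y n) (r n) (c n • a)) F
      (𝓝 ((D p).toLieHom (c₀ • a))) := by
  obtain ⟨hr_zero, hr_pos⟩ := tendsto_nhdsWithin_iff.1 hr
  let γ : ι → ℝ → V := fun n t => S.mul (y n) (S.dilation (r n) (t • c n • a))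
  have hγ : Tendsto (fun x : ι × ℝ => γ x.1 x.2) (F ×ˢ 𝓟 (Set.Icc 0 1)) (𝓝 p) := by
    have hmem : ∀ᶠ x : ι × ℝ in F ×ˢ 𝓟 (Set.Icc 0 1), x.2 ∈ Set.Icc (0 : ℝ) 1 :=
      tendsto_snd.eventually (mem_principal_self _)
    have hparam := bdd_le_mul_tendsto_zero (hmem.mono fun _ hx => hx.1)
      (hmem.mono fun _ hx => hx.2) (hr_zero.comp tendsto_fst)
    refine (Stratification.tendsto_mul_dilation (S := S) (hy.comp tendsto_fst) hparam
      ((hc.smul_const a).comp tendsto_fst)).congr fun x => ?_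
    simp only [γ, Function.comp_apply, S.dilation_of_mem ((S.layer 1).smul_mem _ ha), pow_one,
      smul_smul, mul_assoc, mul_left_comm]
  have hγΩ : ∀ᶠ x in F ×ˢ 𝓟 (Set.Icc (0 : ℝ) 1), γ x.1 x.2 ∈ Ω := hγ (hΩ.mem_nhds hp)
  have hvelocity : Tendsto (fun x : ι × ℝ => (D (γ x.1 x.2)).toLieHom (c x.1 • a))
      (F ×ˢ 𝓟 (Set.Icc 0 1)) (𝓝 ((D p).toLieHom (c₀ • a))) := by
    simp only [map_smul]
    exact (hc.comp tendsto_fst).smul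
      (tendsto_apply_of_homDist (hDp.comp (tendsto_nhdsWithin_iff.2 ⟨hγ, hγΩ⟩)) a)
  have hend := S'.tendsto_endpoint
    (Γ := fun n t => pansuQuotient S S' f (y n) (r n) (t • c n • a))
    (X := fun n t => (D (γ n t)).toLieHom (c n • a))
    (fun n => by rw [zero_smul, pansuQuotient_zero]) ?_ hvelocity
  · simpa only [one_smul] using hend
  filter_upwards [eventually_prod_principal_iff.1 hγΩ, hr_pos] with n hn hrn t ht
  simpa only [← S.smul_mul_smul, pansuQuotient_mul, S'.neg_mul_cancel_left] using
    (hD _ (hn t ht)).tendsto_inv_smul_pansuQuotient (hΩ.mem_nhds (hn t ht))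
      (Set.mem_Ioi.1 hrn).ne' ((S.layer 1).smul_mem (c n) ha)

theorem tendsto_pansuQuotient_of_tendsto [F.NeBot] {y : ι → V} (hy : Tendsto y F (𝓝 p))
    {u : ι → V} {u₀ : V} (hu : Tendsto u F (𝓝 u₀)) :
    Tendsto (fun n => pansuQuotient S S' f (y n) (r n) (u n)) F (𝓝 ((D p).toLieHom u₀)) := by
  have hr_zero := (tendsto_nhdsWithin_iff.1 hr).1
  have hsubgroup : Stratification.IsHorizontalSubgroup S F
      {u | ∃ u₀, Tendsto u F (𝓝 u₀) ∧ ∀ y : ι → V, Tendsto y F (𝓝 p) →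
        Tendsto (fun n => pansuQuotient S S' f (y n) (r n) (u n)) F
          (𝓝 ((D p).toLieHom u₀))} := by
    refine ⟨?_, ?_, fun a ha c c₀ hc => ⟨c₀ • a, hc.smul_const a, fun y hy =>
      tendsto_pansuQuotient_smul hΩ hD hp hDp hr hy ha hc⟩⟩
    · rintro u ⟨u₀, hu, hfu⟩ w ⟨w₀, hw, hfw⟩
      refine ⟨_, Stratification.tendsto_mul (S := S) hu hw, fun y hy => ?_⟩
      simp only [(D p).map_mul, pansuQuotient_mul]
      exact Stratification.tendsto_mul (hfu y hy)
        (hfw _ (Stratification.tendsto_mul_dilation hy hr_zero hu))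
    · rintro u ⟨u₀, hu, hfu⟩
      refine ⟨_, hu.neg, fun y hy => ?_⟩
      simp only [map_neg, pansuQuotient_neg]
      exact (hfu _ (Stratification.tendsto_mul_dilation hy hr_zero hu.neg)).neg
  obtain ⟨u₁, hu₁, hfu⟩ := hsubgroup.mem_of_tendsto hu
  exact tendsto_nhds_unique hu hu₁ ▸ hfu y hy

end Blowup

end Forward

/-- `L` is a strict Pansu differential at `p` of the map `f` defined on `Ω`: the real-valued form
of the limit in `IsStrictlyPansuDifferentiableAt`, free of division by `ρ(x, y)`. -/
def HasStrictPansuDifferentialAt {V V' : Type*} [LieRing V] [LieAlgebra ℝ V] [LieRing V']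
    [LieAlgebra ℝ V'] {S : Stratification V} {S' : Stratification V'}
    (ρ : HomogeneousDistance S) (ρ' : HomogeneousDistance S') (Ω : Set V) (f : V → V')
    (L : HomogeneousHom S S') (p : V) : Prop :=
  ∀ η > 0, ∃ ε > 0, ∀ x ∈ Ω, ∀ y ∈ Ω, ρ.dist p x < ε → ρ.dist p y < ε →
    ρ'.dist (S'.mul (-f y) (f x)) (L.toLieHom (S.mul (-y) x)) ≤ η * ρ.dist x y

theorem isStrictlyPansuDifferentiableAt_iff {V V' : Type*} [LieRing V] [LieAlgebra ℝ V]
    [LieRing V'] [LieAlgebra ℝ V'] {S : Stratification V} {S' : Stratification V'}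
    {ρ : HomogeneousDistance S} {ρ' : HomogeneousDistance S'} {Ω : Set V} {f : V → V'} {p : V} :
    IsStrictlyPansuDifferentiableAt ρ ρ' Ω f p ↔
      ∃ L, HasStrictPansuDifferentialAt ρ ρ' Ω f L p := by
  refine exists_congr fun L => ⟨fun h η hη => ?_, fun h => ?_⟩
  · obtain ⟨ε, hsup, hε⟩ := ((ENNReal.tendsto_nhds_zero.1 h (ENNReal.ofReal η)
      (ENNReal.ofReal_pos.2 hη)).and self_mem_nhdsWithin).exists
    refine ⟨ε, hε, fun x hx y hy hpx hpy => ?_⟩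
    rcases eq_or_ne x y with rfl | hxy
    · rw [S.neg_mul_self, S'.neg_mul_self, map_zero, ρ'.dist_self, ρ.dist_self,
        MulZeroClass.mul_zero]
    simp only [iSup_le_iff, ENNReal.ofReal_le_ofReal_iff hη.le] at hsup
    exact (div_le_iff₀ (ρ.dist_pos hxy)).1 (hsup x y ⟨hx, hy, hpx, hpy, hxy⟩)
  · refine ENNReal.tendsto_nhds_zero.2 fun η hη => ?_
    obtain ⟨η', -, hη', hη'η⟩ := ENNReal.lt_iff_exists_real_btwn.1 hη
    obtain ⟨ε, hε, hbound⟩ := h η' (ENNReal.ofReal_pos.1 hη')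
    filter_upwards [Ioo_mem_nhdsGT hε] with δ hδ
    refine iSup_le fun x => iSup_le fun y => iSup_le fun ⟨hx, hy, hpx, hpy, hxy⟩ => ?_
    exact (ENNReal.ofReal_le_ofReal ((div_le_iff₀ (ρ.dist_pos hxy)).2
      (hbound x hx y hy (hpx.trans hδ.2) (hpy.trans hδ.2)))).trans hη'η.le

section Domain

variable {V : Type*} [LieRing V] [LieAlgebra ℝ V] [FiniteDimensional ℝ V] [TopologicalSpace V]
  [IsTopologicalAddGroup V] [ContinuousSMul ℝ V] [T2Space V] {S : Stratification V}
  {V' : Type*} [LieRing V'] [LieAlgebra ℝ V'] {S' : Stratification V'}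
  {ρ : HomogeneousDistance S} {ρ' : HomogeneousDistance S'} {Ω : Set V} {f : V → V'}
  {L M : HomogeneousHom S S'} {p q : V}

theorem HomogeneousDistance.eventually_dist_lt (ρ : HomogeneousDistance S) {ε : ℝ}
    (hq : ρ.dist p q < ε) : ∀ᶠ x in 𝓝 q, ρ.dist p x < ε :=
  (ρ.tendsto_dist tendsto_const_nhds tendsto_id).eventually_lt_const hq

theorem HasStrictPansuDifferentialAt.hasPansuDifferentialAt
    (h : HasStrictPansuDifferentialAt ρ ρ' Ω f L p) (hp : p ∈ Ω) :
    HasPansuDifferentialAt ρ ρ' Ω f L p := by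
  refine tendsto_order.2 ⟨fun a ha => Eventually.of_forall fun x =>
    ha.trans_le (div_nonneg (ρ'.dist_nonneg _ _) (ρ.dist_nonneg _ _)), fun η hη => ?_⟩
  obtain ⟨ε, hε, hbound⟩ := h (η / 2) (half_pos hη)
  have hself : ρ.dist p p < ε := (ρ.dist_self p).trans_lt hε
  filter_upwards [self_mem_nhdsWithin, nhdsWithin_le_nhds (ρ.eventually_dist_lt hself)]
    with x hx hpx
  rw [ρ.dist_comm p x]
  exact ((div_le_iff₀ (ρ.dist_pos hx.2)).2 (hbound x hx.1 p hp hpx hself)).trans_lt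
    (half_lt_self hη)

theorem HasPansuDifferentialAt.dist_apply_le (hM : HasPansuDifferentialAt ρ ρ' Ω f M q)
    (hΩ : Ω ∈ 𝓝 q) {η : ℝ} (hbound : ∀ᶠ x in 𝓝 q,
      ρ'.dist (S'.mul (-f q) (f x)) (L.toLieHom (S.mul (-q) x)) ≤ η * ρ.dist x q) (v : V) :
    ρ'.dist (M.toLieHom v) (L.toLieHom v) ≤ η * ρ.dist 0 v := by
  have hquot : ∀ᶠ t in 𝓝[>] (0 : ℝ),
      ρ'.dist (pansuQuotient S S' f q t v) (L.toLieHom v) ≤ η * ρ.dist 0 v := by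
    filter_upwards [S.tendsto_mul_dilation_nhdsGT q v hbound, self_mem_nhdsWithin] with t hle ht
    rw [Set.mem_preimage, Set.mem_ofPred_eq, S.neg_mul_cancel_left, ρ.dist_comm,
      ρ.dist_mul_right_eq, ρ.dist_zero_dilation ht, mul_left_comm] at hle
    rw [dist_pansuQuotient f q ρ' L ht]
    exact (div_le_iff₀' ht).2 hle
  have hlim := (hM.tendsto_dist_pansuQuotient hΩ v).add_const (η * ρ.dist 0 v)
  rw [_root_.zero_add] at hlim
  refine ge_of_tendsto hlim (hquot.mono fun t ht => ?_)
  refine (ρ'.dist_triangle _ (pansuQuotient S S' f q t v) _).trans ?_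
  rw [ρ'.dist_comm (M.toLieHom v)]
  exact add_le_add_right ht _

theorem HasStrictPansuDifferentialAt.tendsto_homDist
    (h : HasStrictPansuDifferentialAt ρ ρ' Ω f L p) (hΩ : IsOpen Ω) {D : V → HomogeneousHom S S'}
    (hD : ∀ q ∈ Ω, HasPansuDifferentialAt ρ ρ' Ω f (D q) q) :
    Tendsto (fun q => homDist ρ ρ' (D q) L) (𝓝[Ω] p) (𝓝 0) := by
  refine ENNReal.tendsto_nhds_zero.2 fun η hη => ?_
  obtain ⟨η', -, hη', hη'η⟩ := ENNReal.lt_iff_exists_real_btwn.1 hη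
  obtain ⟨ε, hε, hbound⟩ := h η' (ENNReal.ofReal_pos.1 hη')
  filter_upwards [self_mem_nhdsWithin,
    nhdsWithin_le_nhds (ρ.eventually_dist_lt ((ρ.dist_self p).trans_lt hε))] with q hq hpq
  refine (homDist_le_ofReal ((hD q hq).dist_apply_le (hΩ.mem_nhds hq) ?_)).trans hη'η.le
  filter_upwards [hΩ.mem_nhds hq, ρ.eventually_dist_lt hpq] with x hx hpx
  exact hbound x hx q hq hpx hpq

theorem isC1H_of_isStrictlyPansuDifferentiableAt (hΩ : IsOpen Ω)
    (hf : ∀ p ∈ Ω, IsStrictlyPansuDifferentiableAt ρ ρ' Ω f p) : IsC1H ρ ρ' Ω f := by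
  have : Nonempty (HomogeneousHom S S') :=
    ⟨{ (0 : V →ₗ⁅ℝ⁆ V') with map_layer := fun j _ _ => (S'.layer j).zero_mem }⟩
  choose! D hD using fun p hp => isStrictlyPansuDifferentiableAt_iff.1 (hf p hp)
  have hdiff (p : V) (hp : p ∈ Ω) : HasPansuDifferentialAt ρ ρ' Ω f (D p) p :=
    (hD p hp).hasPansuDifferentialAt hp
  exact ⟨D, hdiff, fun p hp => (hD p hp).tendsto_homDist hΩ hdiff⟩

end Domain

section Forward

variable {V : Type*} [LieRing V] [LieAlgebra ℝ V] [FiniteDimensional ℝ V] [TopologicalSpace V]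
  [IsTopologicalAddGroup V] [ContinuousSMul ℝ V] [T2Space V] {S : Stratification V}
  {V' : Type*} [LieRing V'] [LieAlgebra ℝ V'] [FiniteDimensional ℝ V'] [TopologicalSpace V']
  [IsTopologicalAddGroup V'] [ContinuousSMul ℝ V'] [T2Space V'] {S' : Stratification V'}
  {ρ : HomogeneousDistance S} {ρ' : HomogeneousDistance S'} {Ω : Set V} {f : V → V'}

/-- Along an ultrafilter, the points `δ_{1/ρ(x, y)} (y⁻¹ x)` of the unit sphere converge, which
turns the strict difference quotient into a limit of `pansuQuotient`s. -/
theorem tendsto_strict_quotient (hΩ : IsOpen Ω) {D : V → HomogeneousHom S S'}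
    (hD : ∀ p ∈ Ω, HasPansuDifferentialAt ρ ρ' Ω f (D p) p) {p : V} (hp : p ∈ Ω)
    (hDp : Tendsto (fun q => homDist ρ ρ' (D q) (D p)) (𝓝[Ω] p) (𝓝 0)) :
    Tendsto (fun z : V × V => ρ'.dist (S'.mul (-f z.2) (f z.1))
      ((D p).toLieHom (S.mul (-z.2) z.1)) / ρ.dist z.1 z.2)
      (𝓝 (p, p) ⊓ 𝓟 {z | z.1 ≠ z.2}) (𝓝 0) := by
  refine tendsto_iff_ultrafilter _ _ _ |>.2 fun G hG => ?_
  have hx : Tendsto (fun z : V × V => z.1) G (𝓝 p) :=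
    (continuous_fst.tendsto (p, p)).mono_left (hG.trans inf_le_left)
  have hy : Tendsto (fun z : V × V => z.2) G (𝓝 p) :=
    (continuous_snd.tendsto (p, p)).mono_left (hG.trans inf_le_left)
  have hne : ∀ᶠ z : V × V in G, z.1 ≠ z.2 := hG.trans inf_le_right (mem_principal_self _)
  have hpos : ∀ᶠ z : V × V in G, 0 < ρ.dist z.1 z.2 := hne.mono fun _ => ρ.dist_pos
  have hr : Tendsto (fun z : V × V => ρ.dist z.1 z.2) G (𝓝[>] 0) :=
    tendsto_nhdsWithin_iff.2 ⟨ρ.dist_self p ▸ ρ.tendsto_dist hx hy, hpos⟩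
  obtain ⟨u₀, hu₀⟩ := ρ.exists_tendsto_of_dist_le G
    (u := fun z => S.dilation (ρ.dist z.1 z.2)⁻¹ (S.mul (-z.2) z.1)) (r := 1) (by
      filter_upwards [hpos] with z hz
      rw [ρ.dist_zero_dilation (inv_pos.2 hz), ← ρ.dist_eq_dist_zero, ρ.dist_comm z.2,
        inv_mul_cancel₀ hz.ne'])
  have hL : Continuous (D p).toLieHom :=
    ((D p).toLieHom : V →ₗ[ℝ] V').continuous_of_finiteDimensional
  have hlim := ρ'.tendsto_dist (tendsto_pansuQuotient_of_tendsto hΩ hD hp hDp hr hy hu₀)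
    ((hL.tendsto u₀).comp hu₀)
  rw [ρ'.dist_self] at hlim
  refine hlim.congr' ?_
  filter_upwards [hpos] with z hz
  rw [Function.comp_apply, dist_pansuQuotient _ _ _ _ hz, S.dilation_dilation_inv hz.ne',
    S.mul_neg_cancel_left]

theorem IsC1H.isStrictlyPansuDifferentiableAt (hΩ : IsOpen Ω) (hf : IsC1H ρ ρ' Ω f) {p : V}
    (hp : p ∈ Ω) : IsStrictlyPansuDifferentiableAt ρ ρ' Ω f p := by
  obtain ⟨D, hD, hDcont⟩ := hf
  refine isStrictlyPansuDifferentiableAt_iff.2 ⟨D p, fun η hη => ?_⟩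
  have hquot := eventually_inf_principal.1
    ((tendsto_strict_quotient hΩ hD hp (hDcont p hp)).eventually_lt_const hη)
  obtain ⟨s, hs, t, ht, hst⟩ := mem_nhds_prod_iff.1 hquot
  obtain ⟨ε, hε, hεst⟩ := ρ.exists_dist_lt_imp_mem (inter_mem hs ht)
  refine ⟨ε, hε, fun x _ y _ hpx hpy => ?_⟩
  rcases eq_or_ne x y with rfl | hxy
  · rw [S.neg_mul_self, S'.neg_mul_self, map_zero, ρ'.dist_self, ρ.dist_self,
      MulZeroClass.mul_zero]
  · exact ((div_lt_iff₀ (ρ.dist_pos hxy)).1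
      (hst (Set.mk_mem_prod (hεst x hpx).1 (hεst y hpy).2) hxy)).le

end Forward

end Carnot

theorem mainTheorem10
    {V : Type*} [LieRing V] [LieAlgebra ℝ V] [FiniteDimensional ℝ V]
    [TopologicalSpace V] [IsTopologicalAddGroup V] [ContinuousSMul ℝ V] [T2Space V]
    {V' : Type*} [LieRing V'] [LieAlgebra ℝ V'] [FiniteDimensional ℝ V']
    (S : Carnot.Stratification V) (S' : Carnot.Stratification V')
    (ρ : Carnot.HomogeneousDistance S) (ρ' : Carnot.HomogeneousDistance S')
    (Ω : Set V) (hΩ : IsOpen Ω) (f : V → V') :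
    Carnot.IsC1H ρ ρ' Ω f ↔
      ∀ p ∈ Ω, Carnot.IsStrictlyPansuDifferentiableAt ρ ρ' Ω f p := by
  refine ⟨fun h p hp => ?_, Carnot.isC1H_of_isStrictlyPansuDifferentiableAt hΩ⟩
  let e := (Module.finBasis ℝ V').equivFun
  let _ : TopologicalSpace V' := TopologicalSpace.induced e inferInstance
  have : IsTopologicalAddGroup V' := topologicalAddGroup_induced e
  have : ContinuousSMul ℝ V' := continuousSMul_induced e
  have : T2Space V' := T2Space.of_injective_continuous e.injective continuous_induced_dom
  exact h.isStrictlyPansuDifferentiableAt hΩ hp
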